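/- Let $d\ge 1$ be an integer and let $\mathbf S^d\subset\mathbf R^{d+1}$ be the unit sphere, with $\mathcal P(\mathbf S^d)$ its set of Borel probability measures. Put $\rho(x,y)=\arccos(x\cdot y)$ and $$\Lambda(x,y)=\tfrac{2}{\pi}\min\{\rho(x,y),\pi-\rho(x,y)\},\qquad E_\alpha(\mu)=\tfrac12\iint \Lambda(x,y)^\alpha\,d\mu(x)\,d\mu(y)\quad(0<\alpha<\infty),$$ and let $\operatorname{argmax}_{\mathcal P(\mathbf S^d)}E_\alpha$ be the set of maximizers of $E_\alpha$ on $\mathcal P(\mathbf S^d)$. Call $\mu,\nu\in\mathcal P(\mathbf S^d)$ essentially equivalent, $\mu\equiv\nu$, if there is a rotation $M\in SO(d+1)$ with $\mu(A\cup -A)=\nu(M(A\cup -A))$ for every open $A\subset\mathbf S^d$. Let $\mathcal P_\Delta^=(\mathbf S^d)$ be the set of all $\mu\in\mathcal P(\mathbf S^d)$ with $\mu\equiv\nu$ for some $\nu\in\mathcal P(\mathbf S^d)$ whose support is an orthonormal basis of $\mathbf R^{d+1}$ and which gives mass $\frac1{d+1}$ to each point of its support. Let $\alpha_{\Delta^d}\in[0,\infty]$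 be the threshold exponent, that is, the infimum of all $\alpha\in(0,\infty)$ such that $\mathcal P_\Delta^=(\mathbf S^d)\cap\operatorname{argmax}_{\mathcal P(\mathbf S^d)}E_\alpha\neq\emptyset$ (with $\inf\emptyset=\infty$). **Theorem 3.4 (Maximizers are not unique at threshold exponent).** If $\alpha_{\Delta^d}<\infty$, then $$\mathcal P_\Delta^=(\mathbf S^d)\subset\operatorname{argmax}_{\mathcal P(\mathbf S^d)}E_{\alpha_{\Delta^d}},$$ and the inclusion is strict: there is a maximizer of $E_{\alpha_{\Delta^d}}$ on $\mathcal P(\mathbf S^d)$ that is not essentially equivalent to any element of $\mathcal P_\Delta^=(\mathbf S^d)$. -/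

import Mathlib

open MeasureTheory
open scoped ENNReal

/-- The unit sphere `S^d` of the Euclidean space `ℝ^(d+1)`. -/
abbrev Sph (d : ℕ) : Type :=
  Metric.sphere (0 : EuclideanSpace ℝ (Fin (d + 1))) 1

/-- The geodesic distance `ρ(x,y) = arccos (x ⬝ y)` on `S^d`. -/
noncomputable def geoDist {d : ℕ} (x y : Sph d) : ℝ :=
  Real.arccos (inner ℝ (x : EuclideanSpace ℝ (Fin (d + 1))) (y : EuclideanSpace ℝ (Fin (d + 1))))

/-- `Λ₀(t) = (2/π) min {t, π - t}`. -/
noncomputable def lambdaZero (t : ℝ) : ℝ :=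
  2 / Real.pi * min t (Real.pi - t)

/-- `Λ(x,y) = Λ₀(ρ(x,y))`: the distance of the lines through `x` and `y`, with maximal value `1`. -/
noncomputable def lambdaDist {d : ℕ} (x y : Sph d) : ℝ :=
  lambdaZero (geoDist x y)

/-- The energy `E_α(μ) = (1/2) ∬ Λ(x,y)^α dμ(x) dμ(y)`, for a finite exponent `α > 0`. -/
noncomputable def energy {d : ℕ} (α : ℝ) (μ : ProbabilityMeasure (Sph d)) : ℝ :=
  1 / 2 * ∫ y, ∫ x, lambdaDist x y ^ α ∂(μ : Measure (Sph d)) ∂(μ : Measure (Sph d))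

/-- The set of maximizers of `E_α` among all Borel probability measures on `S^d`. -/
def energyArgmax (d : ℕ) (α : ℝ) : Set (ProbabilityMeasure (Sph d)) :=
  {μ | ∀ ν : ProbabilityMeasure (Sph d), energy α ν ≤ energy α μ}

/-- The self-map of `S^d` induced by a linear isometry of `ℝ^(d+1)`. -/
noncomputable def sphereMap {d : ℕ}
    (M : EuclideanSpace ℝ (Fin (d + 1)) ≃ₗᵢ[ℝ] EuclideanSpace ℝ (Fin (d + 1)))
    (x : Sph d) : Sph d :=
  ⟨M x, by simp⟩

/-- The symmetric set `A ∪ -A`. -/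
def symmUnion {d : ℕ} (A : Set (Sph d)) : Set (Sph d) :=
  A ∪ (fun x => -x) '' A

/-- Essential equivalence `μ ≡ ν`: for some rotation `M` of `ℝ^(d+1)` (an orthogonal map of
determinant one), `μ(A ∪ -A) = ν(M(A ∪ -A))` for each open set `A`. -/
def EssEquiv {d : ℕ} (μ ν : ProbabilityMeasure (Sph d)) : Prop :=
  ∃ M : EuclideanSpace ℝ (Fin (d + 1)) ≃ₗᵢ[ℝ] EuclideanSpace ℝ (Fin (d + 1)),
    LinearMap.det
        (M.toLinearEquiv : EuclideanSpace ℝ (Fin (d + 1)) →ₗ[ℝ] EuclideanSpace ℝ (Fin (d + 1))) = 1 ∧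
      ∀ A : Set (Sph d), IsOpen A →
        (μ : Measure (Sph d)) (symmUnion A) = (ν : Measure (Sph d)) (sphereMap M '' symmUnion A)

/-- The probability measures on `S^d` whose support is an orthonormal basis of `ℝ^(d+1)`. -/
def orthonormalMeasures (d : ℕ) : Set (ProbabilityMeasure (Sph d)) :=
  {μ | ∃ b : OrthonormalBasis (Fin (d + 1)) ℝ (EuclideanSpace ℝ (Fin (d + 1))),
    (fun x : Sph d => (x : EuclideanSpace ℝ (Fin (d + 1)))) '' (μ : Measure (Sph d)).support
      = Set.range b}

/-- The measures in `orthonormalMeasures d` giving mass `1/(d+1)` to each point of the support. -/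
def equiOrthonormalMeasures (d : ℕ) : Set (ProbabilityMeasure (Sph d)) :=
  {μ | μ ∈ orthonormalMeasures d ∧
    ∀ x ∈ (μ : Measure (Sph d)).support, (μ : Measure (Sph d)) {x} = 1 / ((d : ℝ≥0∞) + 1)}

/-- `P_Δ^=(S^d)`: the measures essentially equivalent to a measure equidistributed over an
orthonormal basis. -/
def equiSimplexMeasures (d : ℕ) : Set (ProbabilityMeasure (Sph d)) :=
  {μ | ∃ ν ∈ equiOrthonormalMeasures d, EssEquiv μ ν}

/-- The threshold exponent: the infimum in `[0,∞]` of the exponents `0 < α < ∞` for which some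
element of `P_Δ^=(S^d)` maximizes `E_α`; it is `∞` if there is no such exponent. -/
noncomputable def thresholdExponent (d : ℕ) : ℝ≥0∞ :=
  sInf {a | ∃ α : ℝ, 0 < α ∧ a = ENNReal.ofReal α ∧
    (equiSimplexMeasures d ∩ energyArgmax d α).Nonempty}

/-! ### The kernel -/

section Kernel

variable {d : ℕ}

/-! A measure equidistributed over the lines of an orthonormal basis has `2 * energy α μ = d / (d +
1)` for every `α > 0`. So such a measure maximizes exactly when `α ∈ simplexExponents d`, a set
bounded below by 1 and containing its infimum `a`, by continuity of the energy in `α`. This gives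
the inclusion; strictness needs a maximizer at `a` that is not equidistributed over any orthonormal
basis.

If `a = 1`, rotate the basis by π/4 in one coordinate plane and average the two equidistributed
measures. At exponent 1 the mutual energy is unchanged, because 1/2 + 1/2 = 0 + 1, so the average
still maximizes. At exponent 2 its energy is too small for an equidistributed measure
(`exists_mem_energyArgmax_one`).

If `a > 1`, let exponents increase to `a` and take a limit of maximizers; it maximizes at `a`.
Suppose it were equidistributed. The Euler-Lagrange conditions then force the nearby maximizers to
live in small double caps around the basis lines (`eventually_support_subset`). Inside such caps
spreading does not pay: moving two points of one cap a distance ℓ apart gains `O(ℓ^α)` within the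
cap but loses a multiple of ℓ against another cap, and `α > 1`. Hence `2E ≤ 1 - μ(cap)` for each cap
(`two_energy_le_one_sub_measureReal_doubleCap`). Summing over the caps gives `2E ≤ d / (d + 1)`, so
an exponent below `a` lies in `simplexExponents d`, contradicting minimality. -/

lemma abs_inner_sphere_le_one (x y : Sph d) :
    |inner ℝ (x : EuclideanSpace ℝ (Fin (d + 1))) (y : EuclideanSpace ℝ (Fin (d + 1)))| ≤ 1 := by
  simpa using abs_real_inner_le_norm (x : EuclideanSpace ℝ (Fin (d + 1))) y

lemma Real.arcsin_abs (t : ℝ) : Real.arcsin |t| = |Real.arcsin t| := by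
  rcases le_total 0 t with h | h
  · rw [abs_of_nonneg h, abs_of_nonneg (Real.arcsin_nonneg.2 h)]
  · rw [abs_of_nonpos h, Real.arcsin_neg, abs_of_nonpos (Real.arcsin_nonpos.2 h)]

lemma lambdaDist_eq (x y : Sph d) :
    lambdaDist x y = 1 - 2 / Real.pi * Real.arcsin
      |inner ℝ (x : EuclideanSpace ℝ (Fin (d + 1))) (y : EuclideanSpace ℝ (Fin (d + 1)))| := by
  rw [lambdaDist, lambdaZero, geoDist, Real.arccos, Real.arcsin_abs]
  set a := Real.arcsin (inner ℝ (x : EuclideanSpace ℝ (Fin (d + 1))) y)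
  have hpi := Real.pi_pos
  have : min (Real.pi / 2 - a) (Real.pi - (Real.pi / 2 - a)) = Real.pi / 2 - |a| := by
    rcases le_total 0 a with h | h
    · rw [abs_of_nonneg h, min_eq_left (by linarith)]
    · rw [abs_of_nonpos h, min_eq_right (by linarith)]; ring
  rw [this]
  field_simp

lemma lambdaDist_nonneg (x y : Sph d) : 0 ≤ lambdaDist x y := by
  rw [lambdaDist_eq, div_mul_eq_mul_div, sub_nonneg, div_le_one Real.pi_pos]
  linarith [Real.arcsin_le_pi_div_two
    |inner ℝ (x : EuclideanSpace ℝ (Fin (d + 1))) (y : EuclideanSpace ℝ (Fin (d + 1)))|]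

lemma self_le_arcsin {t : ℝ} (h0 : 0 ≤ t) (h1 : t ≤ 1) : t ≤ Real.arcsin t := by
  have := Real.sin_le (Real.arcsin_nonneg.2 h0)
  rwa [Real.sin_arcsin (by linarith) h1] at this

/-- The linear loss away from orthogonality, from `t ≤ arcsin t`; it is what beats the `ℓ^α` gain
inside a cap. -/
lemma lambdaDist_le_one_sub (x y : Sph d) :
    lambdaDist x y ≤ 1 - 2 / Real.pi *
      |inner ℝ (x : EuclideanSpace ℝ (Fin (d + 1))) (y : EuclideanSpace ℝ (Fin (d + 1)))| := by
  rw [lambdaDist_eq]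
  have := self_le_arcsin (abs_nonneg _) (abs_inner_sphere_le_one x y)
  gcongr

lemma lambdaDist_le_one (x y : Sph d) : lambdaDist x y ≤ 1 := by
  refine (lambdaDist_le_one_sub x y).trans ?_
  have := Real.pi_pos
  rw [sub_le_self_iff]
  positivity

lemma lambdaDist_comm (x y : Sph d) : lambdaDist x y = lambdaDist y x := by
  rw [lambdaDist_eq, lambdaDist_eq, real_inner_comm]

lemma lambdaDist_neg_right (x y : Sph d) : lambdaDist x (-y) = lambdaDist x y := by
  simp [lambdaDist_eq, inner_neg_right]

lemma lambdaDist_neg_left (x y : Sph d) : lambdaDist (-x) y = lambdaDist x y := by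
  simp [lambdaDist_eq, inner_neg_left]

lemma lambdaDist_self (x : Sph d) : lambdaDist x x = 0 := by
  rw [lambdaDist_eq]
  have := Real.pi_ne_zero
  simp

lemma lambdaDist_of_inner_eq_zero {x y : Sph d}
    (h : inner ℝ (x : EuclideanSpace ℝ (Fin (d + 1))) (y : EuclideanSpace ℝ (Fin (d + 1))) = 0) :
    lambdaDist x y = 1 := by
  simp [lambdaDist_eq, h]

lemma eq_or_eq_neg_of_lambdaDist_eq_zero {x y : Sph d} (h : lambdaDist x y = 0) :
    x = y ∨ x = -y := by
  have hpi := Real.pi_pos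
  rw [lambdaDist_eq] at h
  have h1 : Real.arcsin |inner ℝ (x : EuclideanSpace ℝ (Fin (d + 1)))
      (y : EuclideanSpace ℝ (Fin (d + 1)))| = Real.pi / 2 := by
    field_simp at h
    linarith
  rw [Real.arcsin_eq_pi_div_two] at h1
  have hx : ‖(x : EuclideanSpace ℝ (Fin (d + 1)))‖ = 1 := by simp
  have hy : ‖(y : EuclideanSpace ℝ (Fin (d + 1)))‖ = 1 := by simp
  rcases abs_choice (inner ℝ (x : EuclideanSpace ℝ (Fin (d + 1)))
      (y : EuclideanSpace ℝ (Fin (d + 1)))) with h2 | h2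
  · left
    apply Subtype.ext
    rw [← inner_eq_one_iff_of_norm_eq_one hx hy (𝕜 := ℝ)]
    linarith [abs_inner_sphere_le_one x y]
  · right
    apply Subtype.ext
    rw [← inner_eq_one_iff_of_norm_eq_one hx (by simp) (𝕜 := ℝ)]
    simp only [Metric.sphere, coe_neg_sphere, inner_neg_right]
    linarith [abs_inner_sphere_le_one x y]

lemma Continuous.lambdaDist {X : Type*} [TopologicalSpace X] {f g : X → Sph d}
    (hf : Continuous f) (hg : Continuous g) : Continuous fun p => lambdaDist (f p) (g p) := by
  simp_rw [lambdaDist_eq]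
  fun_prop

/-- The chord has length `2 sin(θ/2)`, and Jordan's inequality bounds this below by `2θ/π`. -/
lemma lambdaDist_le_norm_sub (x y : Sph d) :
    lambdaDist x y ≤
      ‖(x : EuclideanSpace ℝ (Fin (d + 1))) - (y : EuclideanSpace ℝ (Fin (d + 1)))‖ := by
  have hpi := Real.pi_pos
  set θ := geoDist x y with hθ
  have h0 : 0 ≤ θ := Real.arccos_nonneg _
  have h1 : θ ≤ Real.pi := Real.arccos_le_pi _
  have hcos : Real.cos θ = inner ℝ (x : EuclideanSpace ℝ (Fin (d + 1))) y :=
    Real.cos_arccos (abs_le.1 (abs_inner_sphere_le_one x y)).1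
      (abs_le.1 (abs_inner_sphere_le_one x y)).2
  have hs : 2 / Real.pi * (θ / 2) ≤ Real.sin (θ / 2) :=
    Real.mul_le_sin (by linarith) (by linarith)
  have hle : lambdaDist x y ≤ 2 * Real.sin (θ / 2) := by
    refine le_trans ?_ (mul_le_mul_of_nonneg_left hs zero_le_two)
    rw [lambdaDist, lambdaZero, ← hθ]
    calc 2 / Real.pi * min θ (Real.pi - θ) ≤ 2 / Real.pi * θ := by
          gcongr; exact min_le_left _ _
      _ = _ := by ring
  refine hle.trans (abs_le_of_sq_le_sq' ?_ (norm_nonneg _)).2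
  rw [norm_sub_sq_real, ← hcos]
  have h3 := Real.cos_two_mul (θ / 2)
  rw [mul_div_cancel₀ θ two_ne_zero] at h3
  have h2 := Real.sin_sq_add_cos_sq (θ / 2)
  simp
  nlinarith

/-- With `A = arcsin a`, `B = arcsin b` one has `sin²(A+B) = a² + b² + 2ab cos(A+B)`, and the cosine
is nonnegative when `A + B ≤ π/2`. Beyond π/2 there is nothing to prove. -/
lemma arcsin_sqrt_add_le {a b : ℝ} (ha : 0 ≤ a) (hb : 0 ≤ b) (h : a ^ 2 + b ^ 2 ≤ 1) :
    Real.arcsin √(a ^ 2 + b ^ 2) ≤ Real.arcsin a + Real.arcsin b := by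
  have ha1 : a ≤ 1 := by nlinarith
  have hb1 : b ≤ 1 := by nlinarith
  have hA := Real.arcsin_nonneg.2 ha
  have hB := Real.arcsin_nonneg.2 hb
  rcases le_total (Real.arcsin a + Real.arcsin b) (Real.pi / 2) with hAB | hAB
  · rw [Real.arcsin_le_iff_le_sin ⟨by linarith [Real.sqrt_nonneg (a ^ 2 + b ^ 2)],
      Real.sqrt_le_one.2 h⟩ ⟨by linarith, hAB⟩]
    have hsn : 0 ≤ Real.sin (Real.arcsin a + Real.arcsin b) :=
      Real.sin_nonneg_of_nonneg_of_le_pi (by linarith) (by linarith)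
    have hcn : 0 ≤ Real.cos (Real.arcsin a + Real.arcsin b) :=
      Real.cos_nonneg_of_neg_pi_div_two_le_of_le (by linarith) hAB
    apply Real.sqrt_le_iff.2 ⟨hsn, ?_⟩
    rw [Real.sin_add]
    rw [Real.cos_add] at hcn
    have e1 := Real.sin_sq_add_cos_sq (Real.arcsin a)
    have e2 := Real.sin_sq_add_cos_sq (Real.arcsin b)
    rw [Real.sin_arcsin (by linarith) ha1, Real.sin_arcsin (by linarith) hb1] at *
    set p := Real.cos (Real.arcsin a)
    set q := Real.cos (Real.arcsin b)
    have hp : p ^ 2 = 1 - a ^ 2 := by linarith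
    have hq : q ^ 2 = 1 - b ^ 2 := by linarith
    have : (a * q + p * b) ^ 2 = a ^ 2 + b ^ 2 + 2 * (a * b) * (p * q - a * b) := by
      linear_combination a ^ 2 * hq + b ^ 2 * hp
    rw [this]
    have := mul_nonneg (mul_nonneg zero_le_two (mul_nonneg ha hb)) hcn
    linarith
  · exact (Real.arcsin_le_pi_div_two _).trans hAB

lemma arcsin_sqrt_sum_le {ι : Type*} (s : Finset ι) (t : ι → ℝ) (ht : ∀ i, 0 ≤ t i)
    (h : ∑ i ∈ s, t i ^ 2 ≤ 1) :
    Real.arcsin √(∑ i ∈ s, t i ^ 2) ≤ ∑ i ∈ s, Real.arcsin (t i) := by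
  classical
  induction s using Finset.induction_on with
  | empty => simp
  | insert i s hi ih =>
    rw [Finset.sum_insert hi] at h ⊢
    rw [Finset.sum_insert hi]
    have hn : 0 ≤ ∑ j ∈ s, t j ^ 2 := Finset.sum_nonneg fun j _ => sq_nonneg _
    have := arcsin_sqrt_add_le (ht i) (Real.sqrt_nonneg (∑ j ∈ s, t j ^ 2))
      (by rwa [Real.sq_sqrt hn])
    rw [Real.sq_sqrt hn] at this
    linarith [ih (by linarith [sq_nonneg (t i)])]

/-- The vectors of an orthonormal basis as points of the sphere. -/
noncomputable def basisPoint (b : OrthonormalBasis (Fin (d + 1)) ℝ (EuclideanSpace ℝ (Fin (d + 1))))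
    (i : Fin (d + 1)) : Sph d :=
  ⟨b i, by simp⟩

variable (b : OrthonormalBasis (Fin (d + 1)) ℝ (EuclideanSpace ℝ (Fin (d + 1))))

lemma lambdaDist_basisPoint_of_ne {i j : Fin (d + 1)} (h : i ≠ j) :
    lambdaDist (basisPoint b i) (basisPoint b j) = 1 :=
  lambdaDist_of_inner_eq_zero (b.orthonormal.2 h)

/-- The squared coordinates of `x` sum to 1, so the arcsines of their absolute values sum to at
least π/2, which removes at least 1 from `d + 1`. -/
lemma sum_lambdaDist_basisPoint_le (x : Sph d) :
    ∑ i, lambdaDist x (basisPoint b i) ≤ d := by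
  have hpi := Real.pi_pos
  have hx : ∑ i, |inner ℝ (x : EuclideanSpace ℝ (Fin (d + 1))) (b i)| ^ 2 = 1 := by
    simpa using b.sum_sq_norm_inner_left (x : EuclideanSpace ℝ (Fin (d + 1)))
  have := arcsin_sqrt_sum_le Finset.univ
    (fun i => |inner ℝ (x : EuclideanSpace ℝ (Fin (d + 1))) (b i)|) (fun _ => abs_nonneg _) hx.le
  rw [hx, Real.sqrt_one, Real.arcsin_one] at this
  simp_rw [lambdaDist_eq]
  rw [Finset.sum_sub_distrib, ← Finset.mul_sum]
  have h2 := mul_le_mul_of_nonneg_left this (by positivity : 0 ≤ 2 / Real.pi)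
  have h3 : 2 / Real.pi * (Real.pi / 2) = 1 := by field_simp
  simp only [basisPoint]
  simp
  linarith

/-- Since `d + 1` terms sum to at most `d`, some term is below 1; off the basis lines it is also
positive, so raising it to a power `α > 1` strictly lowers it. -/
lemma sum_lambdaDist_rpow_lt {α : ℝ} (hα : 1 < α) {x : Sph d}
    (hx : ∀ i, x ≠ basisPoint b i ∧ x ≠ -basisPoint b i) :
    ∑ i, lambdaDist x (basisPoint b i) ^ α < d := by
  have hpos : ∀ i, 0 < lambdaDist x (basisPoint b i) := fun i =>
    (lambdaDist_nonneg _ _).lt_of_ne fun h =>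
      (eq_or_eq_neg_of_lambdaDist_eq_zero h.symm).elim (hx i).1 (hx i).2
  have hle := sum_lambdaDist_basisPoint_le b x
  obtain ⟨j, hj⟩ : ∃ j, lambdaDist x (basisPoint b j) < 1 := by
    by_contra! h
    have : ∑ i : Fin (d + 1), (1 : ℝ) ≤ ∑ i, lambdaDist x (basisPoint b i) :=
      Finset.sum_le_sum fun i _ => h i
    simp at this
    linarith
  refine lt_of_lt_of_le (Finset.sum_lt_sum (fun i _ => ?_) ⟨j, Finset.mem_univ _, ?_⟩) hle
  · simpa using Real.rpow_le_rpow_of_exponent_ge (hpos i) (lambdaDist_le_one _ _) hα.le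
  · simpa using Real.rpow_lt_rpow_of_exponent_gt (hpos j) hj hα

end Kernel

/-! ### Potentials and energies -/

section Potential

open Topology Filter

variable {d : ℕ}

/-- The integral is weakly continuous in the measure and 1-Lipschitz in the integrand, uniformly in
the measure. -/
lemma continuous_prod_integral_continuousMap {X : Type*} [TopologicalSpace X] [CompactSpace X]
    [MeasurableSpace X] [OpensMeasurableSpace X] :
    Continuous fun p : C(X, ℝ) × ProbabilityMeasure X => ∫ x, p.1 x ∂(p.2 : Measure X) := by
  have hint : ∀ (f : C(X, ℝ)) (μ : ProbabilityMeasure X), Integrable f (μ : Measure X) :=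
    fun f μ => (BoundedContinuousFunction.mkOfCompact f).integrable _
  refine continuous_prod_of_continuous_lipschitzWith _ 1 (fun f => ?_) (fun μ => ?_)
  · exact ProbabilityMeasure.continuous_integral_boundedContinuousFunction
      (BoundedContinuousFunction.mkOfCompact f)
  · refine LipschitzWith.of_dist_le_mul fun f g => ?_
    rw [Real.dist_eq, ← integral_sub (hint f μ) (hint g μ), NNReal.coe_one, one_mul,
      ← Real.norm_eq_abs]
    refine (norm_integral_le_of_norm_le_const (C := dist f g) (Eventually.of_forall fun x => ?_)).trans
      (by simp)
    rw [Real.norm_eq_abs, ← Real.dist_eq]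
    exact ContinuousMap.dist_apply_le_dist x

lemma integrable_of_continuous {f : Sph d → ℝ} (hf : Continuous f)
    (μ : Measure (Sph d)) [IsFiniteMeasure μ] : Integrable f μ :=
  (BoundedContinuousFunction.mkOfCompact ⟨f, hf⟩).integrable _

/-- The potential `V(x) = ∫ Λ(x,y)^α dμ(y)`. -/
noncomputable def potential (α : ℝ) (μ : ProbabilityMeasure (Sph d)) (x : Sph d) : ℝ :=
  ∫ y, lambdaDist x y ^ α ∂(μ : Measure (Sph d))

lemma energy_eq_integral_potential (α : ℝ) (μ : ProbabilityMeasure (Sph d)) :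
    energy α μ = 1 / 2 * ∫ y, potential α μ y ∂(μ : Measure (Sph d)) := by
  simp only [energy, potential]
  congr 2
  ext y
  congr 1
  ext x
  rw [lambdaDist_comm]

/-- The exponent ranges over `Set.Ioi 0` because `t ^ α` is not jointly continuous at `(0, 0)`. -/
lemma continuous_kernel : Continuous
    fun p : (Set.Ioi (0 : ℝ) × Sph d) × Sph d => lambdaDist p.1.2 p.2 ^ (p.1.1 : ℝ) := by
  have h2 : Continuous fun p : (Set.Ioi (0 : ℝ) × Sph d) × Sph d => (p.1.1 : ℝ) := by fun_prop
  have h3 : Continuous fun p : (Set.Ioi (0 : ℝ) × Sph d) × Sph d => lambdaDist p.1.2 p.2 :=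
    Continuous.lambdaDist (by fun_prop) (by fun_prop)
  exact h3.rpow h2 fun p => Or.inr p.1.1.2

/-- The kernel `Λ(x,y)^α` as a function of `α`, `x` and `y`. -/
noncomputable def kernelMap : C((Set.Ioi (0 : ℝ) × Sph d) × Sph d, ℝ) :=
  ⟨fun p => lambdaDist p.1.2 p.2 ^ (p.1.1 : ℝ), continuous_kernel⟩

/-- The potential as a function of `α`, `μ` and `x`. -/
noncomputable def potentialMap :
    C((Set.Ioi (0 : ℝ) × ProbabilityMeasure (Sph d)) × Sph d, ℝ) where
  toFun p := potential p.1.1 p.1.2 p.2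
  continuous_toFun :=
    continuous_prod_integral_continuousMap.comp
      (((kernelMap (d := d)).curry.continuous.comp (by fun_prop : Continuous
        fun p : (Set.Ioi (0 : ℝ) × ProbabilityMeasure (Sph d)) × Sph d => (p.1.1, p.2))).prodMk
        (by fun_prop : Continuous
        fun p : (Set.Ioi (0 : ℝ) × ProbabilityMeasure (Sph d)) × Sph d => p.1.2))

lemma continuous_energy :
    Continuous fun p : Set.Ioi (0 : ℝ) × ProbabilityMeasure (Sph d) => energy (p.1 : ℝ) p.2 := by
  simp_rw [energy_eq_integral_potential]
  refine continuous_const.mul ?_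
  exact continuous_prod_integral_continuousMap.comp
    ((potentialMap (d := d)).curry.continuous.prodMk continuous_snd)

lemma continuous_potential {α : ℝ} (hα : 0 < α) (μ : ProbabilityMeasure (Sph d)) :
    Continuous (potential α μ) :=
  ((potentialMap (d := d)).curry (⟨α, hα⟩, μ)).continuous

lemma continuous_lambdaDist_rpow {α : ℝ} (hα : 0 < α) (x : Sph d) :
    Continuous fun y => lambdaDist x y ^ α :=
  ((kernelMap (d := d)).curry (⟨α, hα⟩, x)).continuous

lemma exists_mem_energyArgmax {α : ℝ} (hα : 0 < α) : (energyArgmax d α).Nonempty := by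
  have hne : Nonempty (ProbabilityMeasure (Sph d)) :=
    ⟨⟨Measure.dirac ⟨EuclideanSpace.single 0 1, by simp⟩, inferInstance⟩⟩
  have hc : Continuous fun μ : ProbabilityMeasure (Sph d) => energy α μ :=
    continuous_energy.comp (Continuous.prodMk_right (⟨α, hα⟩ : Set.Ioi (0 : ℝ)))
  obtain ⟨μ, -, hμ⟩ := isCompact_univ.exists_isMaxOn (Set.univ_nonempty) hc.continuousOn
  exact ⟨μ, fun ν => hμ (Set.mem_univ ν)⟩

/-- The convex combination `(1 - t) μ + t ν` of probability measures. -/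
noncomputable def mixture (t : Set.Icc (0 : ℝ) 1) (μ ν : ProbabilityMeasure (Sph d)) :
    ProbabilityMeasure (Sph d) :=
  ⟨ENNReal.ofReal (1 - t) • (μ : Measure (Sph d)) + ENNReal.ofReal t • (ν : Measure (Sph d)),
    ⟨by
      simp only [Measure.add_apply, Measure.smul_apply, measure_univ, smul_eq_mul, mul_one]
      rw [← ENNReal.ofReal_add (by linarith [t.2.2]) t.2.1]
      simp⟩⟩

lemma integral_mixture (t : Set.Icc (0 : ℝ) 1) (μ ν : ProbabilityMeasure (Sph d)) {f : Sph d → ℝ}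
    (hf : Continuous f) :
    ∫ x, f x ∂(mixture t μ ν : Measure (Sph d)) =
      (1 - t) * ∫ x, f x ∂(μ : Measure (Sph d)) + t * ∫ x, f x ∂(ν : Measure (Sph d)) := by
  have h := fun σ : ProbabilityMeasure (Sph d) => integrable_of_continuous hf (σ : Measure (Sph d))
  change ∫ x, f x ∂(ENNReal.ofReal (1 - t) • (μ : Measure (Sph d))
    + ENNReal.ofReal t • (ν : Measure (Sph d))) = _
  rw [integral_add_measure ((h μ).smul_measure ENNReal.ofReal_ne_top)
    ((h ν).smul_measure ENNReal.ofReal_ne_top), integral_smul_measure, integral_smul_measure,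
    ENNReal.toReal_ofReal (by linarith [t.2.2]), ENNReal.toReal_ofReal t.2.1]
  simp

lemma integral_potential_comm {α : ℝ} (hα : 0 < α) (μ ν : ProbabilityMeasure (Sph d)) :
    ∫ x, potential α μ x ∂(ν : Measure (Sph d)) = ∫ x, potential α ν x ∂(μ : Measure (Sph d)) := by
  simp only [potential]
  have hc : Continuous fun p : Sph d × Sph d => lambdaDist p.1 p.2 ^ α :=
    (Continuous.lambdaDist continuous_fst continuous_snd).rpow_const fun _ => Or.inr hα.le
  rw [integral_integral_swap]
  · simp_rw [lambdaDist_comm]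
  · exact (BoundedContinuousFunction.mkOfCompact ⟨_, hc⟩).integrable _

lemma energy_mixture {α : ℝ} (hα : 0 < α) (t : Set.Icc (0 : ℝ) 1)
    (μ ν : ProbabilityMeasure (Sph d)) :
    energy α (mixture t μ ν) = (1 - t) ^ 2 * energy α μ +
      t * (1 - t) * ∫ x, potential α μ x ∂(ν : Measure (Sph d)) + t ^ 2 * energy α ν := by
  have hp : potential α (mixture t μ ν) =
      fun x => (1 - t) * potential α μ x + t * potential α ν x := by
    ext x
    exact integral_mixture t μ ν (continuous_lambdaDist_rpow hα x)
  have hc := continuous_potential (d := d) hα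
  have hi := fun σ τ : ProbabilityMeasure (Sph d) =>
    integrable_of_continuous (hc σ) (τ : Measure (Sph d))
  have hsum : ∀ σ : ProbabilityMeasure (Sph d),
      ∫ x, ((1 - t) * potential α μ x + t * potential α ν x) ∂(σ : Measure (Sph d)) =
      (1 - t) * ∫ x, potential α μ x ∂(σ : Measure (Sph d)) +
        t * ∫ x, potential α ν x ∂(σ : Measure (Sph d)) := fun σ => by
    rw [integral_add ((hi μ σ).const_mul _) ((hi ν σ).const_mul _), integral_const_mul,
      integral_const_mul]
  simp_rw [energy_eq_integral_potential, hp]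
  have hcont : Continuous fun x => (1 - (t : ℝ)) * potential α μ x + t * potential α ν x :=
    (continuous_const.mul (hc μ)).add (continuous_const.mul (hc ν))
  rw [integral_mixture _ _ _ hcont, hsum, hsum, integral_potential_comm hα ν μ]
  ring

/-- The Dirac mass at `x`. -/
noncomputable def diracMeasure (x : Sph d) : ProbabilityMeasure (Sph d) :=
  ⟨Measure.dirac x, inferInstance⟩

lemma energy_diracMeasure {α : ℝ} (hα : 0 < α) (x : Sph d) : energy α (diracMeasure x) = 0 := by
  simp [energy, diracMeasure, lambdaDist_self, Real.zero_rpow hα.ne']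

/-- First-order condition: move a mass `t` to the point `x`, divide the energy inequality by `t` and
let `t → 0`. A Dirac mass has zero energy, so no `t²` term survives. -/
lemma potential_le_of_mem_energyArgmax {α : ℝ} (hα : 0 < α) {μ : ProbabilityMeasure (Sph d)}
    (hμ : μ ∈ energyArgmax d α) (x : Sph d) : potential α μ x ≤ 2 * energy α μ := by
  have h : ∀ t : ℝ, 0 < t → t ≤ 1 → (1 - t) * potential α μ x ≤ (2 - t) * energy α μ := by
    intro t h0 h1
    have := hμ (mixture ⟨t, h0.le, h1⟩ μ (diracMeasure x))
    rw [energy_mixture hα, energy_diracMeasure hα] at this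
    simp only [diracMeasure, ProbabilityMeasure.coe_mk, integral_dirac] at this
    refine le_of_mul_le_mul_left ?_ h0
    linarith
  have h1 : Tendsto (fun t : ℝ => (1 - t) * potential α μ x) (𝓝[>] 0)
      (𝓝 ((1 - 0) * potential α μ x)) :=
    ((by fun_prop : Continuous fun t : ℝ => (1 - t) * potential α μ x).tendsto 0).mono_left
      nhdsWithin_le_nhds
  have h2 : Tendsto (fun t : ℝ => (2 - t) * energy α μ) (𝓝[>] 0) (𝓝 ((2 - 0) * energy α μ)) :=
    ((by fun_prop : Continuous fun t : ℝ => (2 - t) * energy α μ).tendsto 0).mono_left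
      nhdsWithin_le_nhds
  have := le_of_tendsto_of_tendsto h1 h2 (by
    filter_upwards [Ioc_mem_nhdsGT (zero_lt_one' ℝ)] with t ht using h t ht.1 ht.2)
  linarith

/-- The `μ`-average of the potential is `2E`, its upper bound, so equality holds almost everywhere,
hence on the support by continuity. -/
lemma potential_eq_of_mem_support {α : ℝ} (hα : 0 < α) {μ : ProbabilityMeasure (Sph d)}
    (hμ : μ ∈ energyArgmax d α) {x : Sph d} (hx : x ∈ (μ : Measure (Sph d)).support) :
    potential α μ x = 2 * energy α μ := by
  have hle := potential_le_of_mem_energyArgmax hα hμ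
  have hc := continuous_potential hα μ
  have hi := integrable_of_continuous hc (μ : Measure (Sph d))
  have hae : (fun x => 2 * energy α μ - potential α μ x) =ᵐ[(μ : Measure (Sph d))] 0 := by
    rw [← integral_eq_zero_iff_of_nonneg (fun x => sub_nonneg.2 (hle x))
      ((integrable_const _).sub hi), integral_sub (integrable_const _) hi,
      energy_eq_integral_potential]
    simp
  have hcl : IsClosed {x | 2 * energy α μ - potential α μ x = 0} :=
    isClosed_eq (continuous_const.sub hc) continuous_const
  have := Measure.support_subset_of_isClosed hcl hae hx
  simp only [Set.mem_ofPred_eq] at this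
  linarith

end Potential

/-! ### Measures equidistributed over the lines of an orthonormal basis -/

section Simplex

open Topology Filter

variable {d : ℕ}

/-- The pair `{b i, -b i}` of antipodal points. -/
def antipodalPair (b : OrthonormalBasis (Fin (d + 1)) ℝ (EuclideanSpace ℝ (Fin (d + 1))))
    (i : Fin (d + 1)) : Set (Sph d) :=
  {basisPoint b i, -basisPoint b i}

/-- `μ` gives mass `1/(d+1)` to each antipodal pair `±b i`. -/
def IsEquidistributed (μ : ProbabilityMeasure (Sph d))
    (b : OrthonormalBasis (Fin (d + 1)) ℝ (EuclideanSpace ℝ (Fin (d + 1)))) : Prop :=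
  ∀ i, (μ : Measure (Sph d)) (antipodalPair b i) = 1 / ((d : ℝ≥0∞) + 1)

lemma isClosed_antipodalPair
    (b : OrthonormalBasis (Fin (d + 1)) ℝ (EuclideanSpace ℝ (Fin (d + 1)))) (i : Fin (d + 1)) :
    IsClosed (antipodalPair b i) := by
  unfold antipodalPair
  exact (Set.toFinite _).isClosed

lemma measurableSet_antipodalPair
    (b : OrthonormalBasis (Fin (d + 1)) ℝ (EuclideanSpace ℝ (Fin (d + 1)))) (i : Fin (d + 1)) :
    MeasurableSet (antipodalPair b i) :=
  (isClosed_antipodalPair b i).measurableSet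

lemma neg_mem_antipodalPair
    (b : OrthonormalBasis (Fin (d + 1)) ℝ (EuclideanSpace ℝ (Fin (d + 1)))) (i : Fin (d + 1))
    {x : Sph d} : -x ∈ antipodalPair b i ↔ x ∈ antipodalPair b i := by
  simp only [antipodalPair, Set.mem_insert_iff, Set.mem_singleton_iff, neg_inj]
  rw [neg_eq_iff_eq_neg, or_comm]

lemma symmUnion_eq_self {A : Set (Sph d)} (h : ∀ x, -x ∈ A ↔ x ∈ A) : symmUnion A = A := by
  refine Set.union_eq_self_of_subset_right ?_
  rintro _ ⟨x, hx, rfl⟩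
  exact (h x).2 hx

lemma lambdaDist_eq_zero_of_mem_antipodalPair
    {b : OrthonormalBasis (Fin (d + 1)) ℝ (EuclideanSpace ℝ (Fin (d + 1)))} {i : Fin (d + 1)}
    {x : Sph d} (hx : x ∈ antipodalPair b i) : lambdaDist x (basisPoint b i) = 0 := by
  rcases hx with rfl | rfl
  · exact lambdaDist_self _
  · rw [lambdaDist_neg_left, lambdaDist_self]

lemma disjoint_antipodalPair
    (b : OrthonormalBasis (Fin (d + 1)) ℝ (EuclideanSpace ℝ (Fin (d + 1)))) {i j : Fin (d + 1)}
    (h : i ≠ j) : Disjoint (antipodalPair b i) (antipodalPair b j) := by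
  rw [Set.disjoint_left]
  intro x hi hj
  have h1 := lambdaDist_eq_zero_of_mem_antipodalPair hi
  have h2 := lambdaDist_basisPoint_of_ne b h.symm
  rcases hj with rfl | rfl
  · linarith
  · rw [lambdaDist_neg_left] at h1; linarith

lemma natCast_add_one_mul_inv (d : ℕ) : ((d : ℝ≥0∞) + 1) * ((d : ℝ≥0∞) + 1)⁻¹ = 1 :=
  ENNReal.mul_inv_cancel (by simp) (by simp)

lemma IsEquidistributed.ae_mem {μ : ProbabilityMeasure (Sph d)}
    {b : OrthonormalBasis (Fin (d + 1)) ℝ (EuclideanSpace ℝ (Fin (d + 1)))}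
    (h : IsEquidistributed μ b) : ∀ᵐ x ∂(μ : Measure (Sph d)), ∃ i, x ∈ antipodalPair b i := by
  have hU : (μ : Measure (Sph d)) (⋃ i, antipodalPair b i) = 1 := by
    rw [measure_iUnion (fun i j hij => disjoint_antipodalPair b hij)
      (measurableSet_antipodalPair b), tsum_fintype]
    simp [h _, natCast_add_one_mul_inv]
  rw [← prob_compl_eq_zero_iff (MeasurableSet.iUnion (measurableSet_antipodalPair b))] at hU
  have : ∀ᵐ x ∂(μ : Measure (Sph d)), x ∈ ⋃ i, antipodalPair b i := hU
  simpa using this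

lemma IsEquidistributed.integral_eq {μ : ProbabilityMeasure (Sph d)}
    {b : OrthonormalBasis (Fin (d + 1)) ℝ (EuclideanSpace ℝ (Fin (d + 1)))}
    (h : IsEquidistributed μ b) {f : Sph d → ℝ} (hf : ∀ x, f (-x) = f x) :
    ∫ x, f x ∂(μ : Measure (Sph d)) = 1 / ((d : ℝ) + 1) * ∑ i, f (basisPoint b i) := by
  have hae : f =ᵐ[(μ : Measure (Sph d))] fun x =>
      ∑ i, (antipodalPair b i).indicator (fun _ => f (basisPoint b i)) x := by
    filter_upwards [h.ae_mem] with x ⟨i, hi⟩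
    rw [Finset.sum_eq_single i]
    · rw [Set.indicator_of_mem hi]
      rcases hi with rfl | rfl
      · rfl
      · exact hf _
    · intro j _ hji
      exact Set.indicator_of_notMem (Set.disjoint_left.1 (disjoint_antipodalPair b hji.symm) hi) _
    · simp
  rw [integral_congr_ae hae, integral_finsetSum _ fun i _ =>
    (integrable_const _).indicator (measurableSet_antipodalPair b i), Finset.mul_sum]
  refine Finset.sum_congr rfl fun i _ => ?_
  rw [integral_indicator_const _ (measurableSet_antipodalPair b i), measureReal_def, h i,
    ENNReal.toReal_div, ENNReal.toReal_add (by simp) (by simp)]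
  simp

lemma IsEquidistributed.potential_eq {μ : ProbabilityMeasure (Sph d)}
    {b : OrthonormalBasis (Fin (d + 1)) ℝ (EuclideanSpace ℝ (Fin (d + 1)))}
    (h : IsEquidistributed μ b) (α : ℝ) (x : Sph d) :
    potential α μ x = 1 / ((d : ℝ) + 1) * ∑ i, lambdaDist x (basisPoint b i) ^ α :=
  h.integral_eq fun y => by rw [lambdaDist_neg_right]

lemma sum_lambdaDist_rpow_basisPoint
    (b : OrthonormalBasis (Fin (d + 1)) ℝ (EuclideanSpace ℝ (Fin (d + 1)))) {α : ℝ} (hα : 0 < α)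
    (j : Fin (d + 1)) : ∑ i, lambdaDist (basisPoint b j) (basisPoint b i) ^ α = d := by
  rw [← Finset.sum_erase_add _ _ (Finset.mem_univ j), lambdaDist_self, Real.zero_rpow hα.ne',
    Finset.sum_congr rfl (g := fun _ => (1 : ℝ)) fun i hi => by
      rw [lambdaDist_basisPoint_of_ne b (Finset.ne_of_mem_erase hi).symm, Real.one_rpow]]
  simp

lemma IsEquidistributed.energy_eq {μ : ProbabilityMeasure (Sph d)}
    {b : OrthonormalBasis (Fin (d + 1)) ℝ (EuclideanSpace ℝ (Fin (d + 1)))}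
    (h : IsEquidistributed μ b) {α : ℝ} (hα : 0 < α) :
    2 * energy α μ = d / ((d : ℝ) + 1) := by
  have heven : ∀ x, potential α μ (-x) = potential α μ x := fun x => by
    simp only [potential, lambdaDist_neg_left]
  rw [energy_eq_integral_potential, h.integral_eq heven]
  simp_rw [h.potential_eq, sum_lambdaDist_rpow_basisPoint b hα]
  have : (d : ℝ) + 1 ≠ 0 := by positivity
  simp
  field_simp

/-- Pull the basis back by `M`. Equivalence tests only open sets, while antipodal pairs are closed,
so the argument uses their complements, which are open and symmetric. -/
lemma IsEquidistributed.of_essEquiv {μ ν : ProbabilityMeasure (Sph d)}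
    {b : OrthonormalBasis (Fin (d + 1)) ℝ (EuclideanSpace ℝ (Fin (d + 1)))}
    (h : IsEquidistributed ν b) (hμν : EssEquiv μ ν) : ∃ c, IsEquidistributed μ c := by
  obtain ⟨M, -, hM⟩ := hμν
  refine ⟨b.map M.symm, fun i => ?_⟩
  have hpt : ∀ x : Sph d, x = basisPoint (b.map M.symm) i ↔ sphereMap M x = basisPoint b i := by
    intro x
    simp [Subtype.ext_iff, sphereMap, basisPoint, LinearIsometryEquiv.eq_symm_apply]
  have hneg : ∀ x : Sph d, sphereMap M (-x) = -sphereMap M x := by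
    intro x
    simp [Subtype.ext_iff, sphereMap]
  have hmem : ∀ x : Sph d, x ∈ antipodalPair (b.map M.symm) i ↔
      sphereMap M x ∈ antipodalPair b i := by
    intro x
    simp only [antipodalPair, Set.mem_insert_iff, Set.mem_singleton_iff]
    rw [← neg_eq_iff_eq_neg, ← neg_eq_iff_eq_neg, hpt, hpt, hneg]
  have himg : sphereMap M '' (antipodalPair (b.map M.symm) i)ᶜ = (antipodalPair b i)ᶜ := by
    ext y
    constructor
    · rintro ⟨x, hx, rfl⟩
      exact fun h => hx ((hmem x).2 h)
    · intro hy
      have hMy : sphereMap M (sphereMap M.symm y) = y := by simp [sphereMap]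
      refine ⟨sphereMap M.symm y, fun h => hy ?_, hMy⟩
      rw [hmem, hMy] at h
      exact h
  have hsymm := symmUnion_eq_self (A := (antipodalPair (b.map M.symm) i)ᶜ) fun x =>
    not_congr (neg_mem_antipodalPair _ _)
  have := hM _ (isClosed_antipodalPair (b.map M.symm) i).isOpen_compl
  rw [hsymm, himg, prob_compl_eq_one_sub (measurableSet_antipodalPair b i), h i] at this
  have h1 := prob_compl_eq_one_sub (μ := (μ : Measure (Sph d)))
    (measurableSet_antipodalPair (b.map M.symm) i).compl
  rw [compl_compl, this, ENNReal.sub_sub_cancel (by simp)] at h1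
  · exact h1
  · simp

/-- No `-b i` is a basis vector, so it lies off the support and the pair carries only the mass of `b
i`. -/
lemma isEquidistributed_of_mem_equiOrthonormalMeasures {ν : ProbabilityMeasure (Sph d)}
    (h : ν ∈ equiOrthonormalMeasures d) : ∃ b, IsEquidistributed ν b := by
  obtain ⟨⟨b, hb⟩, hm⟩ := h
  have hsupp : ∀ x : Sph d, x ∈ (ν : Measure (Sph d)).support ↔ ∃ i, basisPoint b i = x := by
    intro x
    have := Set.ext_iff.1 hb (x : EuclideanSpace ℝ (Fin (d + 1)))
    simpa [Subtype.ext_iff, basisPoint] using this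
  refine ⟨b, fun i => ?_⟩
  have hneg : -basisPoint b i ∉ (ν : Measure (Sph d)).support := by
    rw [hsupp]
    rintro ⟨j, hj⟩
    have h1 := lambdaDist_self (basisPoint b j)
    nth_rw 1 [hj] at h1
    rw [lambdaDist_neg_left] at h1
    have hij : i = j := by
      by_contra hij
      rw [lambdaDist_basisPoint_of_ne b hij] at h1
      exact one_ne_zero h1
    subst hij
    have := congrArg (fun x : Sph d => inner ℝ (basisPoint b i : EuclideanSpace ℝ (Fin (d + 1)))
      (x : EuclideanSpace ℝ (Fin (d + 1)))) hj
    simp [inner_neg_right] at this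
    norm_num at this
  have h0 : (ν : Measure (Sph d)) {-basisPoint b i} = 0 :=
    measure_mono_null (Set.singleton_subset_iff.2 hneg) Measure.measure_compl_support
  have h1 := hm _ ((hsupp _).2 ⟨i, rfl⟩)
  rw [antipodalPair, Set.insert_eq]
  refine le_antisymm ((measure_union_le _ _).trans ?_) ?_
  · rw [h0, h1, add_zero]
  · rw [← h1]
    exact measure_mono Set.subset_union_left

lemma exists_isEquidistributed_of_mem_equiSimplexMeasures {μ : ProbabilityMeasure (Sph d)}
    (h : μ ∈ equiSimplexMeasures d) : ∃ b, IsEquidistributed μ b := by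
  obtain ⟨ν, hν, hμν⟩ := h
  obtain ⟨b, hb⟩ := isEquidistributed_of_mem_equiOrthonormalMeasures hν
  exact hb.of_essEquiv hμν

/-- The equidistributed measure on the vectors of an orthonormal basis. -/
noncomputable def simplexMeasure
    (b : OrthonormalBasis (Fin (d + 1)) ℝ (EuclideanSpace ℝ (Fin (d + 1)))) :
    ProbabilityMeasure (Sph d) :=
  ⟨((d : ℝ≥0∞) + 1)⁻¹ • ∑ i, Measure.dirac (basisPoint b i), ⟨by
    simp [mul_comm, natCast_add_one_mul_inv]⟩⟩

lemma simplexMeasure_apply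
    (b : OrthonormalBasis (Fin (d + 1)) ℝ (EuclideanSpace ℝ (Fin (d + 1))))
    {s : Set (Sph d)} (hs : MeasurableSet s) : (simplexMeasure b : Measure (Sph d)) s =
      ((d : ℝ≥0∞) + 1)⁻¹ * ∑ i, s.indicator 1 (basisPoint b i) := by
  simp [simplexMeasure, Measure.dirac_apply' _ hs]

lemma basisPoint_injective
    (b : OrthonormalBasis (Fin (d + 1)) ℝ (EuclideanSpace ℝ (Fin (d + 1)))) :
    Function.Injective (basisPoint b) := fun i j h =>
  b.toBasis.injective (by simpa [basisPoint] using h)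

lemma simplexMeasure_mem_equiSimplexMeasures
    (b : OrthonormalBasis (Fin (d + 1)) ℝ (EuclideanSpace ℝ (Fin (d + 1)))) :
    simplexMeasure b ∈ equiSimplexMeasures d := by
  have hsing : ∀ i, (simplexMeasure b : Measure (Sph d)) {basisPoint b i} =
      1 / ((d : ℝ≥0∞) + 1) := by
    intro i
    rw [simplexMeasure_apply b (measurableSet_singleton _), Finset.sum_eq_single i]
    · simp
    · intro j _ hji
      exact Set.indicator_of_notMem (f := (1 : Sph d → ℝ≥0∞)) fun h => hji (basisPoint_injective b h)
    · simp
  have hsupp : (simplexMeasure b : Measure (Sph d)).support = Set.range (basisPoint b) := by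
    apply Set.Subset.antisymm
    · refine Measure.support_subset_of_isClosed (Set.finite_range _).isClosed ?_
      rw [mem_ae_iff, simplexMeasure_apply b (Set.finite_range _).measurableSet.compl]
      simp
    · rintro _ ⟨i, rfl⟩
      rw [Measure.mem_support_iff_forall]
      intro U hU
      refine lt_of_lt_of_le ?_ (measure_mono (Set.singleton_subset_iff.2 (mem_of_mem_nhds hU)))
      rw [hsing]
      simp
  refine ⟨simplexMeasure b, ⟨⟨b, ?_⟩, ?_⟩, LinearIsometryEquiv.refl ℝ _, ?_, fun A _ => ?_⟩
  · rw [hsupp, ← Set.range_comp]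
    rfl
  · rw [hsupp]
    rintro _ ⟨i, rfl⟩
    exact hsing i
  · exact LinearMap.det_id
  · have : sphereMap (LinearIsometryEquiv.refl ℝ (EuclideanSpace ℝ (Fin (d + 1)))) = id := rfl
    rw [this, Set.image_id]

lemma simplexMeasure_isEquidistributed
    (b : OrthonormalBasis (Fin (d + 1)) ℝ (EuclideanSpace ℝ (Fin (d + 1)))) :
    IsEquidistributed (simplexMeasure b) b := by
  intro i
  rw [simplexMeasure_apply b (measurableSet_antipodalPair b i), Finset.sum_eq_single i]
  · simp [antipodalPair]
  · intro j _ hji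
    exact Set.indicator_of_notMem (f := (1 : Sph d → ℝ≥0∞))
      (Set.disjoint_left.1 (disjoint_antipodalPair b hji) (Set.mem_insert _ _))
  · simp

end Simplex

/-! ### Maximizers concentrated near the lines of an orthonormal basis -/

section Caps

variable {d : ℕ}

/-- The closed cap of radius `r` around `b i`, together with the antipodal cap. -/
def doubleCap (b : OrthonormalBasis (Fin (d + 1)) ℝ (EuclideanSpace ℝ (Fin (d + 1))))
    (r : ℝ) (i : Fin (d + 1)) : Set (Sph d) :=
  {x | ‖(x : EuclideanSpace ℝ (Fin (d + 1))) - b i‖ ≤ r ∨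
    ‖(x : EuclideanSpace ℝ (Fin (d + 1))) + b i‖ ≤ r}

lemma isClosed_doubleCap (b : OrthonormalBasis (Fin (d + 1)) ℝ (EuclideanSpace ℝ (Fin (d + 1))))
    (r : ℝ) (i : Fin (d + 1)) : IsClosed (doubleCap b r i) :=
  IsClosed.union
    (isClosed_le (f := fun x : Sph d => ‖(x : EuclideanSpace ℝ (Fin (d + 1))) - b i‖)
      (by fun_prop) continuous_const)
    (isClosed_le (f := fun x : Sph d => ‖(x : EuclideanSpace ℝ (Fin (d + 1))) + b i‖)
      (by fun_prop) continuous_const)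

lemma coe_neg_sph (x : Sph d) : ((-x : Sph d) : EuclideanSpace ℝ (Fin (d + 1))) = -x := rfl

/-- A common point would put `b i` within `2r < 1` of `b j` or `-b j`, but `Λ = 1` bounds both
distances below. -/
lemma disjoint_doubleCap (b : OrthonormalBasis (Fin (d + 1)) ℝ (EuclideanSpace ℝ (Fin (d + 1))))
    {r : ℝ} (hr : r < 1 / 2) {i j : Fin (d + 1)} (hij : i ≠ j) :
    Disjoint (doubleCap b r i) (doubleCap b r j) := by
  rw [Set.disjoint_left]
  intro y hi hj
  have h1 := lambdaDist_le_norm_sub (basisPoint b i) (basisPoint b j)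
  have h2 := lambdaDist_le_norm_sub (basisPoint b i) (-basisPoint b j)
  rw [lambdaDist_neg_right] at h2
  rw [lambdaDist_basisPoint_of_ne b hij] at h1 h2
  simp only [coe_neg_sph, sub_neg_eq_add, basisPoint] at h1 h2
  set z : EuclideanSpace ℝ (Fin (d + 1)) := ↑y
  rcases hi with hi | hi <;> rcases hj with hj | hj
  · have : b i - b j = (z - b j) - (z - b i) := by abel
    rw [this] at h1
    linarith [norm_sub_le (z - b j) (z - b i)]
  · have : b i + b j = (z + b j) - (z - b i) := by abel
    rw [this] at h2
    linarith [norm_sub_le (z + b j) (z - b i)]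
  · have : b i + b j = (z + b i) - (z - b j) := by abel
    rw [this] at h2
    linarith [norm_sub_le (z + b i) (z - b j)]
  · have : b i - b j = (z + b i) - (z + b j) := by abel
    rw [this] at h1
    linarith [norm_sub_le (z + b i) (z + b j)]

/-- Otherwise the squared coordinates of `w` would sum to at most `‖w‖²/4 + ‖w‖²/4`. -/
lemma exists_ne_le_abs_inner (hd : 1 ≤ d)
    (b : OrthonormalBasis (Fin (d + 1)) ℝ (EuclideanSpace ℝ (Fin (d + 1)))) (i : Fin (d + 1))
    {w : EuclideanSpace ℝ (Fin (d + 1))} (hw : |inner ℝ w (b i)| ≤ ‖w‖ / 2) :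
    ∃ j, j ≠ i ∧ ‖w‖ / (2 * (d + 1)) ≤ |inner ℝ w (b j)| := by
  by_contra! h
  have hd' : (1 : ℝ) ≤ d := by exact_mod_cast hd
  have : Nontrivial (Fin (d + 1)) := Fin.nontrivial_iff_two_le.2 (by omega)
  obtain ⟨j, hj⟩ := exists_ne i
  have hpos : 0 < ‖w‖ := by
    have := (abs_nonneg _).trans_lt (h j hj)
    by_contra! h0
    have : ‖w‖ / (2 * (d + 1)) ≤ 0 := div_nonpos_of_nonpos_of_nonneg h0 (by positivity)
    linarith
  have hs : ∑ k, |inner ℝ w (b k)| ^ 2 = ‖w‖ ^ 2 := by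
    simpa using b.sum_sq_norm_inner_left w
  rw [← Finset.sum_erase_add _ _ (Finset.mem_univ i)] at hs
  have h1 : ∑ k ∈ Finset.univ.erase i, |inner ℝ w (b k)| ^ 2 ≤
      ∑ k ∈ Finset.univ.erase i, (‖w‖ / (2 * ((d : ℝ) + 1))) ^ 2 :=
    Finset.sum_le_sum fun k hk =>
      pow_le_pow_left₀ (abs_nonneg _) (h k (Finset.ne_of_mem_erase hk)).le 2
  have h2 : |inner ℝ w (b i)| ^ 2 ≤ (‖w‖ / 2) ^ 2 := pow_le_pow_left₀ (abs_nonneg _) hw 2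
  have h3 : (d : ℝ) * (‖w‖ / (2 * ((d : ℝ) + 1))) ^ 2 ≤ ‖w‖ ^ 2 / 4 := by
    rw [div_pow, mul_div_assoc', div_le_div_iff₀ (by positivity) (by positivity)]
    nlinarith [mul_nonneg (sq_nonneg ‖w‖) (by positivity : (0 : ℝ) ≤ d ^ 2 + d + 1)]
  rw [Finset.sum_const, Finset.card_erase_of_mem (Finset.mem_univ i), Finset.card_univ,
    Fintype.card_fin, Nat.add_sub_cancel, nsmul_eq_mul] at h1
  nlinarith [sq_pos_of_pos hpos]

/-- Chords of a small cap are nearly tangential: `x - x'` is orthogonal to `x + x'`, so only the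
deviation of the midpoint from `v` contributes. -/
lemma abs_inner_sub_le {v : EuclideanSpace ℝ (Fin (d + 1))} {x x' : Sph d} {r : ℝ}
    (hx : ‖(x : EuclideanSpace ℝ (Fin (d + 1))) - v‖ ≤ r)
    (hx' : ‖(x' : EuclideanSpace ℝ (Fin (d + 1))) - v‖ ≤ r) :
    |inner ℝ ((x : EuclideanSpace ℝ (Fin (d + 1))) - x') v| ≤
      ‖(x : EuclideanSpace ℝ (Fin (d + 1))) - x'‖ * r := by
  have hx1 : ‖(x : EuclideanSpace ℝ (Fin (d + 1)))‖ = 1 := by simp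
  have hx1' : ‖(x' : EuclideanSpace ℝ (Fin (d + 1)))‖ = 1 := by simp
  set z : EuclideanSpace ℝ (Fin (d + 1)) := ↑x
  set z' : EuclideanSpace ℝ (Fin (d + 1)) := ↑x'
  have horth : inner ℝ (z - z') (z + z') = (0 : ℝ) := by
    rw [inner_sub_left, inner_add_right, inner_add_right, real_inner_self_eq_norm_sq,
      real_inner_self_eq_norm_sq, real_inner_comm, hx1, hx1']
    ring
  have h1 : inner ℝ (z - z') v =
      -inner ℝ (z - z') ((1 / 2 : ℝ) • (z - v) + (1 / 2 : ℝ) • (z' - v)) := by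
    have : (1 / 2 : ℝ) • (z - v) + (1 / 2 : ℝ) • (z' - v) = (1 / 2 : ℝ) • (z + z') - v := by
      module
    rw [this, inner_sub_right, inner_smul_right, horth]
    ring
  rw [h1, abs_neg]
  refine (abs_real_inner_le_norm _ _).trans (mul_le_mul_of_nonneg_left ?_ (norm_nonneg _))
  refine (norm_add_le _ _).trans ?_
  rw [norm_smul, norm_smul]
  norm_num
  linarith

lemma lambdaDist_rpow_le_self {α : ℝ} (hα : 1 ≤ α) (x y : Sph d) :
    lambdaDist x y ^ α ≤ lambdaDist x y := by
  simpa using Real.rpow_le_rpow_of_exponent_ge' (lambdaDist_nonneg x y) (lambdaDist_le_one x y)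
    zero_le_one hα

/-- Since `|⟨x,y⟩| + |⟨x',y⟩| ≥ |⟨x - x',y⟩|`, the two points cannot both be orthogonal to `y`.
Replacing `b j` by `y` costs at most `‖x - x'‖ r`, half of the available lower bound. -/
lemma lambdaDist_rpow_add_le
    (b : OrthonormalBasis (Fin (d + 1)) ℝ (EuclideanSpace ℝ (Fin (d + 1)))) {α : ℝ} (hα : 1 ≤ α)
    {r : ℝ} (hr : r ≤ 1 / (4 * (d + 1))) {x x' y : Sph d} {j : Fin (d + 1)}
    (hj : ‖(x : EuclideanSpace ℝ (Fin (d + 1))) - x'‖ / (2 * (d + 1)) ≤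
      |inner ℝ ((x : EuclideanSpace ℝ (Fin (d + 1))) - x') (b j)|)
    (hy : y ∈ doubleCap b r j) :
    lambdaDist x y ^ α + lambdaDist x' y ^ α ≤
      2 - ‖(x : EuclideanSpace ℝ (Fin (d + 1))) - x'‖ / (2 * Real.pi * (d + 1)) := by
  have hpi := Real.pi_pos
  have h1 := (lambdaDist_rpow_le_self hα x y).trans (lambdaDist_le_one_sub x y)
  have h2 := (lambdaDist_rpow_le_self hα x' y).trans (lambdaDist_le_one_sub x' y)
  set z : EuclideanSpace ℝ (Fin (d + 1)) := ↑x
  set z' : EuclideanSpace ℝ (Fin (d + 1)) := ↑x'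
  have h3 : |inner ℝ (z - z') (y : EuclideanSpace ℝ (Fin (d + 1)))| ≤
      |inner ℝ z (y : EuclideanSpace ℝ (Fin (d + 1)))| +
        |inner ℝ z' (y : EuclideanSpace ℝ (Fin (d + 1)))| := by
    rw [inner_sub_left]
    exact abs_sub _ _
  have h4 : |inner ℝ (z - z') (b j)| - ‖z - z'‖ * r ≤
      |inner ℝ (z - z') (y : EuclideanSpace ℝ (Fin (d + 1)))| := by
    rcases hy with hy | hy
    · have e : inner ℝ (z - z') (b j) = inner ℝ (z - z') (y : EuclideanSpace ℝ (Fin (d + 1))) -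
          inner ℝ (z - z') ((y : EuclideanSpace ℝ (Fin (d + 1))) - b j) := by
        rw [inner_sub_right]; ring
      have := (abs_real_inner_le_norm (z - z') ((y : EuclideanSpace ℝ (Fin (d + 1))) - b j)).trans
        (mul_le_mul_of_nonneg_left hy (norm_nonneg _))
      have h := abs_sub (inner ℝ (z - z') (y : EuclideanSpace ℝ (Fin (d + 1))))
        (inner ℝ (z - z') ((y : EuclideanSpace ℝ (Fin (d + 1))) - b j))
      rw [← e] at h
      linarith
    · have e : inner ℝ (z - z') (b j) =
          inner ℝ (z - z') ((y : EuclideanSpace ℝ (Fin (d + 1))) + b j) -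
          inner ℝ (z - z') (y : EuclideanSpace ℝ (Fin (d + 1))) := by
        rw [inner_add_right]; ring
      have := (abs_real_inner_le_norm (z - z') ((y : EuclideanSpace ℝ (Fin (d + 1))) + b j)).trans
        (mul_le_mul_of_nonneg_left hy (norm_nonneg _))
      have h := abs_sub (inner ℝ (z - z') ((y : EuclideanSpace ℝ (Fin (d + 1))) + b j))
        (inner ℝ (z - z') (y : EuclideanSpace ℝ (Fin (d + 1))))
      rw [← e] at h
      linarith
  have h5 : ‖z - z'‖ * r ≤ ‖z - z'‖ * (1 / (4 * (d + 1))) :=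
    mul_le_mul_of_nonneg_left hr (norm_nonneg _)
  have h6 : ‖z - z'‖ / (4 * (d + 1)) ≤
      |inner ℝ z (y : EuclideanSpace ℝ (Fin (d + 1)))| +
        |inner ℝ z' (y : EuclideanSpace ℝ (Fin (d + 1)))| := by
    have e : ‖z - z'‖ / (4 * ((d : ℝ) + 1)) =
      ‖z - z'‖ / (2 * (d + 1)) - ‖z - z'‖ * (1 / (4 * (d + 1))) := by
      field_simp; norm_num
    linarith
  have h7 := mul_le_mul_of_nonneg_left h6 (by positivity : 0 ≤ 2 / Real.pi)
  have h8 : 2 / Real.pi * (‖z - z'‖ / (4 * ((d : ℝ) + 1))) =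
      ‖z - z'‖ / (2 * Real.pi * (d + 1)) := by
    field_simp; ring
  rw [h8] at h7
  linarith

lemma potential_neg (α : ℝ) (μ : ProbabilityMeasure (Sph d)) (x : Sph d) :
    potential α μ (-x) = potential α μ x := by
  simp only [potential, lambdaDist_neg_left]

/-- Passing to the antipode if necessary brings the point near `b i` itself without changing any
value of `Λ`. -/
lemma exists_lambdaDist_eq_of_mem_doubleCap
    {b : OrthonormalBasis (Fin (d + 1)) ℝ (EuclideanSpace ℝ (Fin (d + 1)))} {r : ℝ}
    {i : Fin (d + 1)} {x : Sph d} (hx : x ∈ doubleCap b r i) :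
    ∃ z : Sph d, ‖(z : EuclideanSpace ℝ (Fin (d + 1))) - b i‖ ≤ r ∧
      ∀ y, lambdaDist z y = lambdaDist x y := by
  rcases hx with hx | hx
  · exact ⟨x, hx, fun _ => rfl⟩
  · refine ⟨-x, ?_, lambdaDist_neg_left x⟩
    rwa [coe_neg_sph, ← neg_add', norm_neg]

lemma potential_add_le {α : ℝ} (hα : 0 < α) (μ : ProbabilityMeasure (Sph d)) {A B : Set (Sph d)}
    (hA : MeasurableSet A) (hB : MeasurableSet B) (hAB : Disjoint A B) {x x' : Sph d} {c L : ℝ}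
    (hcA : ∀ y ∈ (μ : Measure (Sph d)).support, y ∈ A →
      lambdaDist x y ^ α + lambdaDist x' y ^ α ≤ 2 * c)
    (hLB : ∀ y ∈ B, lambdaDist x y ^ α + lambdaDist x' y ^ α ≤ 2 - L) :
    potential α μ x + potential α μ x' ≤ 2 - 2 * (1 - c) * (μ : Measure (Sph d)).real A -
      L * (μ : Measure (Sph d)).real B := by
  have hi1 := integrable_of_continuous (continuous_lambdaDist_rpow hα x) (μ : Measure (Sph d))
  have hi2 := integrable_of_continuous (continuous_lambdaDist_rpow hα x') (μ : Measure (Sph d))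
  have hA' : Integrable (A.indicator fun _ => 2 * (1 - c)) (μ : Measure (Sph d)) :=
    (integrable_const _).indicator hA
  have hB' : Integrable (B.indicator fun _ => L) (μ : Measure (Sph d)) :=
    (integrable_const _).indicator hB
  have h2 : Integrable (fun _ : Sph d => (2 : ℝ)) (μ : Measure (Sph d)) := integrable_const _
  have h2A : Integrable (fun y => (2 : ℝ) - A.indicator (fun _ => 2 * (1 - c)) y)
      (μ : Measure (Sph d)) := h2.sub hA'
  have hint : ∫ y, ((2 : ℝ) - A.indicator (fun _ => 2 * (1 - c)) y - B.indicator (fun _ => L) y)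
      ∂(μ : Measure (Sph d)) = 2 - 2 * (1 - c) * (μ : Measure (Sph d)).real A -
        L * (μ : Measure (Sph d)).real B := by
    rw [integral_sub h2A hB', integral_sub h2 hA', integral_indicator_const _ hA,
      integral_indicator_const _ hB, integral_const, probReal_univ, smul_eq_mul, smul_eq_mul,
      smul_eq_mul]
    ring
  rw [← hint, potential, potential, ← integral_add hi1 hi2]
  refine integral_mono_ae (hi1.add hi2) (h2A.sub hB') ?_
  filter_upwards [Measure.support_mem_ae (μ := (μ : Measure (Sph d)))] with y hy
  by_cases hyA : y ∈ A
  · rw [Set.indicator_of_mem hyA, Set.indicator_of_notMem (Set.disjoint_left.1 hAB hyA)]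
    linarith [hcA y hy hyA]
  · rw [Set.indicator_of_notMem hyA]
    by_cases hyB : y ∈ B
    · rw [Set.indicator_of_mem hyB]
      linarith [hLB y hyB]
    · rw [Set.indicator_of_notMem hyB]
      have h1 := Real.rpow_le_one (lambdaDist_nonneg x y) (lambdaDist_le_one x y) hα.le
      have h2 := Real.rpow_le_one (lambdaDist_nonneg x' y) (lambdaDist_le_one x' y) hα.le
      linarith

lemma exists_forall_lambdaDist_le {K : Set (Sph d)} (hK : IsCompact K) (hne : K.Nonempty) :
    ∃ p ∈ K, ∃ p' ∈ K, ∀ q ∈ K, ∀ q' ∈ K, lambdaDist q q' ≤ lambdaDist p p' := by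
  have hc : Continuous fun q : Sph d × Sph d => lambdaDist q.1 q.2 :=
    Continuous.lambdaDist continuous_fst continuous_snd
  obtain ⟨⟨p, p'⟩, hp, hmax⟩ := (hK.prod hK).exists_isMaxOn (hne.prod hne) hc.continuousOn
  rw [isMaxOn_iff] at hmax
  refine ⟨p, hp.1, p', hp.2, fun q hq q' hq' => ?_⟩
  simpa only using hmax (q, q') (Set.mk_mem_prod hq hq')

/-- Write `δ^α = δ · δ^(α-1)`: since `α > 1`, the second factor is small in small caps. -/
lemma rpow_le_mul_of_le {α δ ℓ r κ : ℝ} (hα : 1 < α) (hδ0 : 0 ≤ δ) (hδℓ : δ ≤ ℓ) (hℓr : ℓ ≤ 2 * r)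
    (hκ : (2 * r) ^ (α - 1) ≤ κ) : δ ^ α ≤ ℓ * κ := by
  have hℓ0 := hδ0.trans hδℓ
  have hκ0 : 0 ≤ κ := (Real.rpow_nonneg (hℓ0.trans hℓr) _).trans hκ
  rcases hδ0.eq_or_lt with h0 | h0
  · rw [← h0, Real.zero_rpow (by linarith)]
    positivity
  · have e : δ ^ α = δ * δ ^ (α - 1) := by
      rw [Real.rpow_sub_one h0.ne']
      field_simp
    rw [e]
    exact mul_le_mul hδℓ ((Real.rpow_le_rpow hδ0 (hδℓ.trans hℓr) (by linarith)).trans hκ)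
      (by positivity) hℓ0

lemma two_energy_le_one_sub_measureReal_doubleCap (hd : 1 ≤ d) {α : ℝ} (hα : 1 < α)
    {μ : ProbabilityMeasure (Sph d)} (hμ : μ ∈ energyArgmax d α)
    (b : OrthonormalBasis (Fin (d + 1)) ℝ (EuclideanSpace ℝ (Fin (d + 1)))) {r : ℝ}
    (hr : r ≤ 1 / (4 * (d + 1)))
    (hr' : (2 * r) ^ (α - 1) ≤ 1 / (8 * Real.pi * (d + 1) ^ 2))
    (hmass : ∀ i, 1 / (2 * ((d : ℝ) + 1)) ≤ (μ : Measure (Sph d)).real (doubleCap b r i))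
    (i : Fin (d + 1)) :
    2 * energy α μ ≤ 1 - (μ : Measure (Sph d)).real (doubleCap b r i) := by
  have hpi := Real.pi_pos
  have hα0 : 0 < α := by linarith
  have hr8 : r ≤ 1 / 4 := hr.trans (by
    apply one_div_le_one_div_of_le (by norm_num); linarith [(Nat.cast_nonneg d : (0 : ℝ) ≤ d)])
  have hmeas := fun k => (isClosed_doubleCap b r k).measurableSet
  have hK : IsCompact ((μ : Measure (Sph d)).support ∩ doubleCap b r i) :=
    (Measure.isClosed_support.inter (isClosed_doubleCap b r i)).isCompact
  have hne : ((μ : Measure (Sph d)).support ∩ doubleCap b r i).Nonempty := by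
    rw [Set.inter_comm]
    apply Measure.nonempty_inter_support_of_pos
    have : 0 < (μ : Measure (Sph d)).real (doubleCap b r i) :=
      lt_of_lt_of_le (by positivity) (hmass i)
    exact (ENNReal.toReal_pos_iff.1 this).1
  -- The pair realizes the `Λ`-diameter of the support within the cap, so its contribution from this
  -- cap is at most `δ^α` per unit of mass at either point.
  obtain ⟨p, hp, p', hp', hmax⟩ := exists_forall_lambdaDist_le hK hne
  obtain ⟨x, hx, hxp⟩ := exists_lambdaDist_eq_of_mem_doubleCap hp.2
  obtain ⟨x', hx', hxp'⟩ := exists_lambdaDist_eq_of_mem_doubleCap hp'.2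
  set δ := lambdaDist p p' with hδ
  set ℓ := ‖(x : EuclideanSpace ℝ (Fin (d + 1))) - x'‖ with hℓ
  have hℓ0 : 0 ≤ ℓ := norm_nonneg _
  have hδ0 : 0 ≤ δ := lambdaDist_nonneg _ _
  have hδℓ : δ ≤ ℓ := by
    rw [hδ, ← hxp, lambdaDist_comm, ← hxp', lambdaDist_comm]
    exact lambdaDist_le_norm_sub _ _
  have hℓr : ℓ ≤ 2 * r := by
    have := norm_sub_le ((x : EuclideanSpace ℝ (Fin (d + 1))) - b i)
      ((x' : EuclideanSpace ℝ (Fin (d + 1))) - b i)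
    rw [sub_sub_sub_cancel_right] at this
    linarith
  have hδα : δ ^ α ≤ ℓ * (1 / (8 * Real.pi * (d + 1) ^ 2)) :=
    rpow_le_mul_of_le hα hδ0 hδℓ hℓr hr'
  obtain ⟨j, hji, hj⟩ := exists_ne_le_abs_inner hd b i
    (w := (x : EuclideanSpace ℝ (Fin (d + 1))) - x') ((abs_inner_sub_le hx hx').trans (by
      rw [← hℓ]; nlinarith))
  set L := ℓ / (2 * Real.pi * (d + 1)) with hL
  set mi := (μ : Measure (Sph d)).real (doubleCap b r i)
  set mj := (μ : Measure (Sph d)).real (doubleCap b r j)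
  have hle : potential α μ x + potential α μ x' ≤ 2 - 2 * (1 - δ ^ α) * mi - L * mj := by
    refine potential_add_le hα0 μ (hmeas i) (hmeas j)
      (disjoint_doubleCap b (by linarith) hji.symm) (fun y hy hyi => ?_) (fun y hyj => ?_)
    · rw [hxp, hxp']
      have h1 := Real.rpow_le_rpow (lambdaDist_nonneg p y) (hmax p hp y ⟨hy, hyi⟩) hα0.le
      have h2 := Real.rpow_le_rpow (lambdaDist_nonneg p' y) (hmax p' hp' y ⟨hy, hyi⟩) hα0.le
      linarith
    · exact lambdaDist_rpow_add_le b hα.le hr hj hyj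
  have hVp : potential α μ x = 2 * energy α μ := by
    rw [← potential_eq_of_mem_support hα0 hμ hp.1]
    simp only [potential, hxp]
  have hVp' : potential α μ x' = 2 * energy α μ := by
    rw [← potential_eq_of_mem_support hα0 hμ hp'.1]
    simp only [potential, hxp']
  have hmi1 : mi ≤ 1 := measureReal_le_one
  have hmi0 : 0 ≤ mi := measureReal_nonneg
  have hδα0 : 0 ≤ δ ^ α := Real.rpow_nonneg hδ0 _
  have hLm : L * (1 / (2 * ((d : ℝ) + 1))) ≤ L * mj :=
    mul_le_mul_of_nonneg_left (hmass j) (by positivity)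
  -- The constant in `hr'` is chosen so that the loss `L * mj` is at least `2 δ^α`, hence absorbs
  -- the gain `2 δ^α mi`.
  have e : L * (1 / (2 * ((d : ℝ) + 1))) = 2 * (ℓ * (1 / (8 * Real.pi * (d + 1) ^ 2))) := by
    rw [hL]; field_simp; norm_num
  have : δ ^ α * mi ≤ δ ^ α := mul_le_of_le_one_right hδα0 hmi1
  linarith

lemma two_energy_le_of_support_subset_doubleCap (hd : 1 ≤ d) {α : ℝ} (hα : 1 < α)
    {μ : ProbabilityMeasure (Sph d)} (hμ : μ ∈ energyArgmax d α)
    (b : OrthonormalBasis (Fin (d + 1)) ℝ (EuclideanSpace ℝ (Fin (d + 1)))) {r : ℝ}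
    (hr : r ≤ 1 / (4 * (d + 1)))
    (hr' : (2 * r) ^ (α - 1) ≤ 1 / (8 * Real.pi * (d + 1) ^ 2))
    (hmass : ∀ i, 1 / (2 * ((d : ℝ) + 1)) ≤ (μ : Measure (Sph d)).real (doubleCap b r i))
    (hsupp : (μ : Measure (Sph d)).support ⊆ ⋃ i, doubleCap b r i) :
    2 * energy α μ ≤ d / ((d : ℝ) + 1) := by
  have h1 : ∑ _i : Fin (d + 1), 2 * energy α μ ≤
      ∑ i, (1 - (μ : Measure (Sph d)).real (doubleCap b r i)) :=
    Finset.sum_le_sum fun i _ =>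
      two_energy_le_one_sub_measureReal_doubleCap hd hα hμ b hr hr' hmass i
  have h2 : (1 : ℝ) ≤ ∑ i, (μ : Measure (Sph d)).real (doubleCap b r i) := by
    have h : (μ : Measure (Sph d)).real (⋃ i, doubleCap b r i) = 1 := by
      rw [measureReal_def, (prob_compl_eq_zero_iff (MeasurableSet.iUnion fun k =>
        (isClosed_doubleCap b r k).measurableSet)).1 (measure_mono_null
          (Set.compl_subset_compl.2 hsupp) Measure.measure_compl_support), ENNReal.toReal_one]
    exact h.symm.le.trans (measureReal_iUnion_fintype_le _)
  rw [Finset.sum_sub_distrib, Finset.sum_const, Finset.sum_const, Finset.card_univ,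
    Fintype.card_fin, nsmul_eq_mul, nsmul_eq_mul] at h1
  push_cast at h1
  rw [le_div_iff₀ (by positivity)]
  linarith

end Caps

/-! ### The threshold exponent -/

section Threshold

open Topology Filter

variable {d : ℕ}

lemma arcsin_sqrt_two_div_two : Real.arcsin (√2 / 2) = Real.pi / 4 := by
  rw [← Real.sin_pi_div_four, Real.arcsin_sin] <;> linarith [Real.pi_pos]

lemma sum_lambdaDist_rpow_of_abs_inner_eq
    (b : OrthonormalBasis (Fin (d + 1)) ℝ (EuclideanSpace ℝ (Fin (d + 1)))) (α : ℝ)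
    {i j : Fin (d + 1)} (hij : i ≠ j) {x : Sph d}
    (hi : |inner ℝ (x : EuclideanSpace ℝ (Fin (d + 1))) (b i)| = √2 / 2)
    (hj : |inner ℝ (x : EuclideanSpace ℝ (Fin (d + 1))) (b j)| = √2 / 2)
    (h0 : ∀ k, k ≠ i → k ≠ j → inner ℝ (x : EuclideanSpace ℝ (Fin (d + 1))) (b k) = 0) :
    ∑ k, lambdaDist x (basisPoint b k) ^ α = d - 1 + 2 * (1 / 2) ^ α := by
  have hpi := Real.pi_pos
  have hhalf : 1 - 2 / Real.pi * (Real.pi / 4) = 1 / 2 := by field_simp; norm_num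
  have hi' : lambdaDist x (basisPoint b i) = 1 / 2 := by
    rw [lambdaDist_eq, basisPoint, hi, arcsin_sqrt_two_div_two, hhalf]
  have hj' : lambdaDist x (basisPoint b j) = 1 / 2 := by
    rw [lambdaDist_eq, basisPoint, hj, arcsin_sqrt_two_div_two, hhalf]
  have h : ∀ k, lambdaDist x (basisPoint b k) ^ α =
      1 - (if k = i then 1 - (1 / 2 : ℝ) ^ α else 0) -
        (if k = j then 1 - (1 / 2 : ℝ) ^ α else 0) := by
    intro k
    by_cases hki : k = i
    · subst hki
      rw [hi', if_pos rfl, if_neg hij]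
      ring
    · by_cases hkj : k = j
      · subst hkj
        rw [hj', if_pos rfl, if_neg hki]
        ring
      · rw [if_neg hki, if_neg hkj, lambdaDist_of_inner_eq_zero (h0 k hki hkj), Real.one_rpow]
        ring
  simp_rw [h]
  rw [Finset.sum_sub_distrib, Finset.sum_sub_distrib, Finset.sum_ite_eq', Finset.sum_ite_eq']
  simp
  ring

/-- The orthonormal family obtained from `b` by rotating `b i` and `b j` by an angle `π/4`. -/
noncomputable def bisectorFamily
    (b : OrthonormalBasis (Fin (d + 1)) ℝ (EuclideanSpace ℝ (Fin (d + 1)))) (i j : Fin (d + 1))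
    (k : Fin (d + 1)) : EuclideanSpace ℝ (Fin (d + 1)) :=
  if k = i then (√2 / 2) • b i + (√2 / 2) • b j
  else if k = j then (√2 / 2) • b i + (-(√2 / 2)) • b j
  else b k

lemma sqrt_two_div_two_mul_self : √2 / 2 * (√2 / 2) = 1 / 2 := by
  have := Real.mul_self_sqrt (zero_le_two (α := ℝ))
  linarith

lemma inner_smul_add_smul (b : OrthonormalBasis (Fin (d + 1)) ℝ (EuclideanSpace ℝ (Fin (d + 1))))
    (i j k : Fin (d + 1)) (s t : ℝ) :
    inner ℝ (s • b i + t • b j) (b k) = (if i = k then s else 0) + (if j = k then t else 0) := by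
  rw [inner_add_left, real_inner_smul_left, real_inner_smul_left,
    orthonormal_iff_ite.1 b.orthonormal, orthonormal_iff_ite.1 b.orthonormal]
  simp

lemma orthonormal_bisectorFamily
    (b : OrthonormalBasis (Fin (d + 1)) ℝ (EuclideanSpace ℝ (Fin (d + 1)))) {i j : Fin (d + 1)}
    (hij : i ≠ j) : Orthonormal ℝ (bisectorFamily b i j) := by
  have hs := sqrt_two_div_two_mul_self
  have hb := orthonormal_iff_ite.1 b.orthonormal
  rw [orthonormal_iff_ite]
  intro k l
  by_cases hki : k = i <;> by_cases hkj : k = j <;> by_cases hli : l = i <;>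
    by_cases hlj : l = j <;> by_cases hkl : k = l <;>
    first
    | (exfalso; simp_all; done)
    | (simp only [bisectorFamily, hki, hkj, hli, hlj, hkl, hij, hij.symm, if_true, if_false,
        inner_add_right, real_inner_smul_right, inner_smul_add_smul, hb] <;>
       simp_all [eq_comm] <;> linarith)

/-- The orthonormal basis obtained from `b` by rotating `b i` and `b j` by an angle `π/4`. -/
lemma exists_bisectorBasis
    (b : OrthonormalBasis (Fin (d + 1)) ℝ (EuclideanSpace ℝ (Fin (d + 1)))) {i j : Fin (d + 1)}
    (hij : i ≠ j) :
    ∃ c : OrthonormalBasis (Fin (d + 1)) ℝ (EuclideanSpace ℝ (Fin (d + 1))),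
      ∀ k, c k = bisectorFamily b i j k := by
  have h : Orthonormal ℝ ((Set.univ : Set (Fin (d + 1))).domRestrict (bisectorFamily b i j)) :=
    (orthonormal_bisectorFamily b hij).comp _ Subtype.val_injective
  obtain ⟨c, hc⟩ := h.exists_orthonormalBasis_extension_of_card_eq (by simp)
  exact ⟨c, fun k => hc k (Set.mem_univ k)⟩

lemma sum_lambdaDist_rpow_bisector
    (b c : OrthonormalBasis (Fin (d + 1)) ℝ (EuclideanSpace ℝ (Fin (d + 1)))) {i j : Fin (d + 1)}
    (hij : i ≠ j) (hc : ∀ k, c k = bisectorFamily b i j k) {l : Fin (d + 1)} (hl : l = i ∨ l = j)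
    (α : ℝ) :
    ∑ k, lambdaDist (basisPoint c l) (basisPoint b k) ^ α = d - 1 + 2 * (1 / 2) ^ α := by
  have hs : 0 ≤ √2 / 2 := by positivity
  rcases hl with rfl | rfl
  · have hv : c l = (√2 / 2) • b l + (√2 / 2) • b j := by rw [hc, bisectorFamily, if_pos rfl]
    refine sum_lambdaDist_rpow_of_abs_inner_eq b α hij ?_ ?_ fun k hk hk' => ?_ <;>
      simp only [basisPoint, hv, inner_smul_add_smul]
    · rw [if_pos trivial, if_neg hij.symm, add_zero, abs_of_nonneg hs]
    · rw [if_pos trivial, if_neg hij, zero_add, abs_of_nonneg hs]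
    · rw [if_neg (Ne.symm hk), if_neg (Ne.symm hk'), add_zero]
  · have hv : c l = (√2 / 2) • b i + (-(√2 / 2)) • b l := by
      rw [hc, bisectorFamily, if_neg hij.symm, if_pos rfl]
    refine sum_lambdaDist_rpow_of_abs_inner_eq b α hij ?_ ?_ fun k hk hk' => ?_ <;>
      simp only [basisPoint, hv, inner_smul_add_smul]
    · rw [if_pos trivial, if_neg hij.symm, add_zero, abs_of_nonneg hs]
    · rw [if_pos trivial, if_neg hij, zero_add, abs_neg, abs_of_nonneg hs]
    · rw [if_neg (Ne.symm hk), if_neg (Ne.symm hk'), add_zero]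

lemma sum_lambdaDist_bisector
    (b c : OrthonormalBasis (Fin (d + 1)) ℝ (EuclideanSpace ℝ (Fin (d + 1)))) {i j : Fin (d + 1)}
    (hij : i ≠ j) (hc : ∀ k, c k = bisectorFamily b i j k) (l : Fin (d + 1)) :
    ∑ k, lambdaDist (basisPoint c l) (basisPoint b k) ^ (1 : ℝ) = d := by
  by_cases hl : l = i ∨ l = j
  · rw [sum_lambdaDist_rpow_bisector b c hij hc hl, Real.rpow_one]
    ring
  · have : basisPoint c l = basisPoint b l := by
      push Not at hl
      rw [basisPoint, basisPoint, Subtype.mk.injEq, hc, bisectorFamily, if_neg hl.1, if_neg hl.2]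
    rw [this, sum_lambdaDist_rpow_basisPoint b zero_lt_one]

/-- The exponents for which equidistributed measures maximize the energy. -/
def simplexExponents (d : ℕ) : Set ℝ :=
  {α | 0 < α ∧ ∀ ν : ProbabilityMeasure (Sph d), 2 * energy α ν ≤ d / ((d : ℝ) + 1)}

/-- The right-hand side does not depend on `μ` or `b`: all equidistributed measures maximize
together or not at all. -/
lemma IsEquidistributed.mem_energyArgmax_iff {μ : ProbabilityMeasure (Sph d)}
    {b : OrthonormalBasis (Fin (d + 1)) ℝ (EuclideanSpace ℝ (Fin (d + 1)))}
    (h : IsEquidistributed μ b) {α : ℝ} (hα : 0 < α) :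
    μ ∈ energyArgmax d α ↔ α ∈ simplexExponents d := by
  have := h.energy_eq hα
  refine ⟨fun hμ => ⟨hα, fun ν => ?_⟩, fun hS ν => ?_⟩
  · linarith [hμ ν]
  · linarith [hS.2 ν]

/-- The standard orthonormal basis of `ℝ^(d+1)`. -/
noncomputable def standardBasis (d : ℕ) :
    OrthonormalBasis (Fin (d + 1)) ℝ (EuclideanSpace ℝ (Fin (d + 1))) :=
  EuclideanSpace.basisFun (Fin (d + 1)) ℝ

lemma thresholdExponent_eq (d : ℕ) :
    thresholdExponent d = sInf (ENNReal.ofReal '' simplexExponents d) := by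
  rw [thresholdExponent]
  congr 1
  ext a
  constructor
  · rintro ⟨α, hα, rfl, μ, hμ, hμ'⟩
    obtain ⟨b, hb⟩ := exists_isEquidistributed_of_mem_equiSimplexMeasures hμ
    exact ⟨α, (hb.mem_energyArgmax_iff hα).1 hμ', rfl⟩
  · rintro ⟨α, hα, rfl⟩
    exact ⟨α, hα.1, rfl, simplexMeasure (standardBasis d),
      simplexMeasure_mem_equiSimplexMeasures _,
      ((simplexMeasure_isEquidistributed _).mem_energyArgmax_iff hα.1).2 hα⟩

lemma exists_ne_fin (hd : 1 ≤ d) : ∃ i j : Fin (d + 1), i ≠ j :=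
  ⟨0, ⟨1, by omega⟩, by simp [Fin.ext_iff]⟩

/-- At a bisector of two basis vectors the potential times `d + 1` is `d - 1 + 2 · 2^(-α)`, which
exceeds `d` when `α < 1` and violates the Euler-Lagrange inequality. -/
lemma one_le_of_mem_simplexExponents (hd : 1 ≤ d) {α : ℝ} (hα : α ∈ simplexExponents d) :
    1 ≤ α := by
  obtain ⟨i, j, hij⟩ := exists_ne_fin hd
  have hb := simplexMeasure_isEquidistributed (standardBasis d)
  obtain ⟨c, hc⟩ := exists_bisectorBasis (standardBasis d) hij
  have h := potential_le_of_mem_energyArgmax hα.1 ((hb.mem_energyArgmax_iff hα.1).2 hα)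
    (basisPoint c i)
  rw [hb.potential_eq, hb.energy_eq hα.1, sum_lambdaDist_rpow_bisector _ c hij hc (Or.inl rfl),
    one_div_mul_eq_div, div_le_div_iff_of_pos_right (by positivity)] at h
  by_contra! h1
  have := Real.rpow_lt_rpow_of_exponent_gt (x := (1 / 2 : ℝ)) (by norm_num) (by norm_num) h1
  rw [Real.rpow_one] at this
  linarith

/-- The lower bound 1 keeps the infimum inside the range `α > 0` where the energy is continuous. -/
lemma exists_isLeast_simplexExponents (hd : 1 ≤ d) (hne : (simplexExponents d).Nonempty) :
    IsLeast (simplexExponents d) (sInf (simplexExponents d)) := by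
  have hbdd : BddBelow (simplexExponents d) := ⟨1, fun α => one_le_of_mem_simplexExponents hd⟩
  have h1 : 1 ≤ sInf (simplexExponents d) :=
    le_csInf hne fun α => one_le_of_mem_simplexExponents hd
  obtain ⟨u, -, hu, huS⟩ := exists_seq_tendsto_sInf hne hbdd
  refine ⟨⟨by linarith, fun ν => ?_⟩, fun α hα => csInf_le hbdd hα⟩
  have hu' : Tendsto (fun n => (⟨u n, (huS n).1⟩ : Set.Ioi (0 : ℝ))) atTop
      (𝓝 ⟨sInf (simplexExponents d), zero_lt_one.trans_le h1⟩) := tendsto_subtype_rng.2 hu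
  have := (continuous_energy (d := d)).continuousAt.tendsto.comp (hu'.prodMk_nhds
    (tendsto_const_nhds (x := ν)))
  exact le_of_tendsto (this.const_mul 2) (Eventually.of_forall fun n => (huS n).2 ν)

lemma isLeast_toReal_thresholdExponent (hd : 1 ≤ d) (hfin : thresholdExponent d < ⊤) :
    IsLeast (simplexExponents d) (thresholdExponent d).toReal := by
  have hne : (simplexExponents d).Nonempty := by
    by_contra h
    rw [Set.not_nonempty_iff_eq_empty] at h
    rw [thresholdExponent_eq, h] at hfin
    simp at hfin
  have hl := exists_isLeast_simplexExponents hd hne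
  have : thresholdExponent d = ENNReal.ofReal (sInf (simplexExponents d)) := by
    rw [thresholdExponent_eq]
    exact (ENNReal.ofReal_mono.map_isLeast hl).csInf_eq
  rwa [this, ENNReal.toReal_ofReal hl.1.1.le]

lemma exists_mem_energyArgmax_one (hd : 1 ≤ d) (h1 : 1 ∈ simplexExponents d) :
    ∃ μ ∈ energyArgmax d 1, ∀ b, ¬ IsEquidistributed μ b := by
  obtain ⟨i, j, hij⟩ := exists_ne_fin hd
  set b := standardBasis d
  have hb := simplexMeasure_isEquidistributed b
  obtain ⟨c, hc⟩ := exists_bisectorBasis b hij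
  have hc' := simplexMeasure_isEquidistributed c
  have hd1 : (d : ℝ) + 1 ≠ 0 := by positivity
  have hcross : ∫ x, potential 1 (simplexMeasure b) x ∂(simplexMeasure c : Measure (Sph d)) =
      d / ((d : ℝ) + 1) := by
    rw [hc'.integral_eq fun x => potential_neg _ _ x]
    simp_rw [hb.potential_eq, sum_lambdaDist_bisector b c hij hc]
    simp
    field_simp
  refine ⟨mixture ⟨1 / 2, by norm_num, by norm_num⟩ (simplexMeasure b) (simplexMeasure c),
    fun ν => ?_, fun e he => ?_⟩
  · rw [energy_mixture one_pos, hcross]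
    have := hb.energy_eq one_pos
    have := hc'.energy_eq one_pos
    have := h1.2 ν
    simp only
    linarith
  -- Exponent 2 serves as a test: equidistributed measures have the same energy at every exponent,
  -- whereas the cross term of the mixture drops strictly, its row `i` having sum `d - 1/2`.
  · have hle : ∀ l, ∑ k, lambdaDist (basisPoint c l) (basisPoint b k) ^ (2 : ℝ) ≤ d := fun l =>
      (Finset.sum_le_sum fun k _ => lambdaDist_rpow_le_self one_le_two _ _).trans
        (sum_lambdaDist_basisPoint_le b _)
    have hlt : ∑ l, ∑ k, lambdaDist (basisPoint c l) (basisPoint b k) ^ (2 : ℝ) <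
        ∑ _l : Fin (d + 1), (d : ℝ) := by
      refine Finset.sum_lt_sum (fun l _ => hle l) ⟨i, Finset.mem_univ i, ?_⟩
      rw [sum_lambdaDist_rpow_bisector b c hij hc (Or.inl rfl)]
      norm_num
      linarith
    have hcross2 : ∫ x, potential 2 (simplexMeasure b) x ∂(simplexMeasure c : Measure (Sph d)) <
        d / ((d : ℝ) + 1) := by
      rw [hc'.integral_eq fun x => potential_neg _ _ x]
      simp_rw [hb.potential_eq]
      rw [← Finset.mul_sum]
      rw [Finset.sum_const, Finset.card_univ, Fintype.card_fin, nsmul_eq_mul] at hlt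
      push_cast at hlt
      have hpos : 0 < (d : ℝ) + 1 := by positivity
      calc _ < 1 / ((d : ℝ) + 1) * (1 / ((d : ℝ) + 1) * (((d : ℝ) + 1) * d)) := by gcongr
        _ = _ := by field_simp
    have h2 := he.energy_eq two_pos
    rw [energy_mixture two_pos] at h2
    have := hb.energy_eq two_pos
    have := hc'.energy_eq two_pos
    simp only at h2
    linarith

end Threshold

/-! ### Limits of maximizers below the threshold -/

section Limit

open Topology Filter

variable {d : ℕ}

/-- The defect `2 E_α(μ) - V(x)` in the Euler-Lagrange inequality. -/
noncomputable def defectMap : C((Set.Ioi (0 : ℝ) × ProbabilityMeasure (Sph d)) × Sph d, ℝ) where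
  toFun p := 2 * energy (p.1.1 : ℝ) p.1.2 - potential p.1.1 p.1.2 p.2
  continuous_toFun :=
    ((continuous_energy.comp continuous_fst).const_mul 2).sub (potentialMap (d := d)).continuous

/-- The points of the sphere at distance at least `r` from all `±b i`. -/
def farSet (b : OrthonormalBasis (Fin (d + 1)) ℝ (EuclideanSpace ℝ (Fin (d + 1)))) (r : ℝ) :
    Set (Sph d) :=
  {x | ∀ i, r ≤ ‖(x : EuclideanSpace ℝ (Fin (d + 1))) - b i‖ ∧
    r ≤ ‖(x : EuclideanSpace ℝ (Fin (d + 1))) + b i‖}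

lemma isCompact_farSet (b : OrthonormalBasis (Fin (d + 1)) ℝ (EuclideanSpace ℝ (Fin (d + 1))))
    (r : ℝ) : IsCompact (farSet b r) := by
  refine IsClosed.isCompact ?_
  simp only [farSet, Set.ofPred_forall, Set.ofPred_and]
  refine isClosed_iInter fun i => IsClosed.inter ?_ ?_
  · exact isClosed_le (g := fun x : Sph d => ‖(x : EuclideanSpace ℝ (Fin (d + 1))) - b i‖)
      continuous_const (by fun_prop)
  · exact isClosed_le (g := fun x : Sph d => ‖(x : EuclideanSpace ℝ (Fin (d + 1))) + b i‖)
      continuous_const (by fun_prop)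

lemma mem_iUnion_doubleCap_of_notMem_farSet
    {b : OrthonormalBasis (Fin (d + 1)) ℝ (EuclideanSpace ℝ (Fin (d + 1)))} {r : ℝ} {x : Sph d}
    (hx : x ∉ farSet b r) : x ∈ ⋃ i, doubleCap b r i := by
  by_contra h
  refine hx fun i => ?_
  have : x ∉ doubleCap b r i := fun hi => h (Set.mem_iUnion_of_mem i hi)
  by_contra h'
  rw [not_and_or, not_le, not_le] at h'
  exact this (h'.imp le_of_lt le_of_lt)

lemma potential_lt_of_mem_farSet {μ : ProbabilityMeasure (Sph d)}
    {b : OrthonormalBasis (Fin (d + 1)) ℝ (EuclideanSpace ℝ (Fin (d + 1)))}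
    (h : IsEquidistributed μ b) {α : ℝ} (hα : 1 < α) {r : ℝ} (hr : 0 < r) {x : Sph d}
    (hx : x ∈ farSet b r) : potential α μ x < 2 * energy α μ := by
  rw [h.potential_eq, h.energy_eq (by linarith), one_div_mul_eq_div,
    div_lt_div_iff_of_pos_right (by positivity)]
  refine sum_lambdaDist_rpow_lt b hα fun i => ⟨?_, ?_⟩
  · rintro rfl
    have := (hx i).1
    simp [basisPoint] at this
    linarith
  · rintro rfl
    have := (hx i).2
    rw [coe_neg_sph] at this
    simp [basisPoint] at this
    linarith

/-- Portmanteau on the open double cap, whose limiting mass is at least `1/(d+1)`; the factor 1/2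
supplies the strict inequality. -/
lemma eventually_measureReal_doubleCap_ge {ι : Type*} {F : Filter ι}
    {m : ι → ProbabilityMeasure (Sph d)} {μ : ProbabilityMeasure (Sph d)}
    (hm : Tendsto m F (𝓝 μ))
    {b : OrthonormalBasis (Fin (d + 1)) ℝ (EuclideanSpace ℝ (Fin (d + 1)))}
    (h : IsEquidistributed μ b) {r : ℝ} (hr : 0 < r) (i : Fin (d + 1)) :
    ∀ᶠ n in F, 1 / (2 * ((d : ℝ) + 1)) ≤ (m n : Measure (Sph d)).real (doubleCap b r i) := by
  set G : Set (Sph d) := {x | ‖(x : EuclideanSpace ℝ (Fin (d + 1))) - b i‖ < r} ∪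
    {x | ‖(x : EuclideanSpace ℝ (Fin (d + 1))) + b i‖ < r} with hG
  have hGo : IsOpen G := IsOpen.union
    (isOpen_lt (f := fun x : Sph d => ‖(x : EuclideanSpace ℝ (Fin (d + 1))) - b i‖)
      (by fun_prop) continuous_const)
    (isOpen_lt (f := fun x : Sph d => ‖(x : EuclideanSpace ℝ (Fin (d + 1))) + b i‖)
      (by fun_prop) continuous_const)
  have hGc : G ⊆ doubleCap b r i := fun x hx => Or.imp le_of_lt le_of_lt hx
  have hpG : antipodalPair b i ⊆ G := by
    rintro x (rfl | rfl)
    · left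
      simpa [basisPoint] using hr
    · right
      change ‖((-basisPoint b i : Sph d) : EuclideanSpace ℝ (Fin (d + 1))) + b i‖ < r
      rw [coe_neg_sph]
      simpa [basisPoint] using hr
  have hμG : ENNReal.ofReal (1 / (2 * ((d : ℝ) + 1))) < (μ : Measure (Sph d)) G := by
    refine lt_of_lt_of_le ?_ (measure_mono hpG)
    have e : (1 : ℝ≥0∞) / ((d : ℝ≥0∞) + 1) = ENNReal.ofReal (1 / ((d : ℝ) + 1)) := by
      rw [ENNReal.ofReal_div_of_pos (by positivity), ENNReal.ofReal_one,
        ENNReal.ofReal_add (by positivity) zero_le_one, ENNReal.ofReal_natCast, ENNReal.ofReal_one]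
    rw [h i, e, ENNReal.ofReal_lt_ofReal_iff (by positivity)]
    apply one_div_lt_one_div_of_lt (by positivity)
    linarith [(Nat.cast_nonneg d : (0 : ℝ) ≤ d)]
  have := lt_of_lt_of_le hμG (ProbabilityMeasure.le_liminf_measure_open_of_tendsto hm hGo)
  filter_upwards [eventually_lt_of_lt_liminf this] with n hn
  have h1 := hn.le.trans (measure_mono hGc)
  exact (ENNReal.ofReal_le_iff_le_toReal (measure_ne_top _ _)).1 h1

/-- The limiting defect is positive on the compact far set, where `a > 1` gives strictness. Mapping
a compact set into an open one is an open condition, so the defect of `m n` is eventually positive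
there too; but it vanishes on the support. -/
lemma eventually_support_subset {ι : Type*} {F : Filter ι} {a : Set.Ioi (0 : ℝ)}
    {u : ι → Set.Ioi (0 : ℝ)} (hu : Tendsto u F (𝓝 a))
    {m : ι → ProbabilityMeasure (Sph d)} {μ : ProbabilityMeasure (Sph d)}
    (hm : Tendsto m F (𝓝 μ)) (hmax : ∀ n, m n ∈ energyArgmax d (u n))
    {b : OrthonormalBasis (Fin (d + 1)) ℝ (EuclideanSpace ℝ (Fin (d + 1)))}
    (h : IsEquidistributed μ b) (ha : 1 < (a : ℝ)) {r : ℝ} (hr : 0 < r) :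
    ∀ᶠ n in F, (m n : Measure (Sph d)).support ⊆ ⋃ i, doubleCap b r i := by
  have hopen := ContinuousMap.isOpen_setOfPred_mapsTo (isCompact_farSet b r) (isOpen_Ioi (a := (0 : ℝ)))
  have ht : Tendsto (fun n => (defectMap (d := d)).curry (u n, m n)) F
      (𝓝 ((defectMap (d := d)).curry (a, μ))) :=
    ((defectMap (d := d)).curry.continuous.tendsto (a, μ)).comp (hu.prodMk_nhds hm)
  have hmem : Set.MapsTo ((defectMap (d := d)).curry (a, μ)) (farSet b r) (Set.Ioi 0) :=
    fun x hx => sub_pos.2 (potential_lt_of_mem_farSet h ha hr hx)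
  filter_upwards [ht.eventually (hopen.mem_nhds hmem)] with n hn x hx
  refine mem_iUnion_doubleCap_of_notMem_farSet fun hxK => ?_
  have h1 : 0 < 2 * energy (u n : ℝ) (m n) - potential (u n : ℝ) (m n) x := hn hxK
  rw [potential_eq_of_mem_support (u n).2 (hmax n) hx, sub_self] at h1
  exact lt_irrefl _ h1

lemma exists_radius (d : ℕ) {β : ℝ} (hβ : 0 < β) :
    ∃ r : ℝ, 0 < r ∧ r ≤ 1 / (4 * (d + 1)) ∧
      (2 * r) ^ β ≤ 1 / (8 * Real.pi * ((d : ℝ) + 1) ^ 2) := by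
  have hpi := Real.pi_pos
  have h1 : Tendsto (fun r : ℝ => (2 * r) ^ β) (𝓝[>] 0) (𝓝 0) := by
    have hc : Continuous fun r : ℝ => (2 * r) ^ β :=
      (continuous_const.mul continuous_id).rpow_const fun _ => Or.inr hβ.le
    have := hc.tendsto 0
    simp only [mul_zero, Real.zero_rpow hβ.ne'] at this
    exact this.mono_left nhdsWithin_le_nhds
  have h2 := h1.eventually (ge_mem_nhds (by positivity :
    (0 : ℝ) < 1 / (8 * Real.pi * ((d : ℝ) + 1) ^ 2)))
  have h3 : ∀ᶠ r : ℝ in 𝓝[>] 0, r ∈ Set.Ioc (0 : ℝ) (1 / (4 * (d + 1))) :=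
    Ioc_mem_nhdsGT (by positivity)
  obtain ⟨r, hr, hr'⟩ := (h2.and h3).exists
  exact ⟨r, hr'.1, hr'.2, hr⟩

lemma mem_energyArgmax_of_tendsto {ι : Type*} {F : Filter ι} [F.NeBot] {a : Set.Ioi (0 : ℝ)}
    {u : ι → Set.Ioi (0 : ℝ)} (hu : Tendsto u F (𝓝 a))
    {m : ι → ProbabilityMeasure (Sph d)} {μ : ProbabilityMeasure (Sph d)}
    (hm : Tendsto m F (𝓝 μ)) (hmax : ∀ n, m n ∈ energyArgmax d (u n)) :
    μ ∈ energyArgmax d a := by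
  intro ν
  have h1 := (continuous_energy (d := d)).continuousAt.tendsto.comp (hu.prodMk_nhds
    (tendsto_const_nhds (x := ν)))
  have h2 := (continuous_energy (d := d)).continuousAt.tendsto.comp (hu.prodMk_nhds hm)
  exact le_of_tendsto_of_tendsto' h1 h2 fun n => hmax n ν

lemma exists_mem_energyArgmax_of_one_lt (hd : 1 ≤ d) {a : ℝ} (ha : IsLeast (simplexExponents d) a)
    (ha1 : 1 < a) : ∃ μ ∈ energyArgmax d a, ∀ b, ¬ IsEquidistributed μ b := by
  by_contra! hcon
  -- The shift by 2 keeps every exponent, including the one for `n = 0`, uniformly above 1.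
  have hpos : ∀ n : ℕ, (1 + a) / 2 ≤ a - (a - 1) / (n + 2) := fun n => by
    have : (a - 1) / (n + 2) ≤ (a - 1) / 2 := by
      apply div_le_div_of_nonneg_left (by linarith) two_pos
      linarith [(Nat.cast_nonneg n : (0 : ℝ) ≤ n)]
    linarith
  set u : ℕ → Set.Ioi (0 : ℝ) := fun n =>
    ⟨a - (a - 1) / (n + 2), lt_of_lt_of_le (by linarith) (hpos n)⟩ with hu_def
  have hlt : ∀ n, (u n : ℝ) < a := fun n => by
    have : 0 < (a - 1) / ((n : ℝ) + 2) := div_pos (by linarith) (by positivity)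
    simp only [hu_def]
    linarith
  have hu : Tendsto u (hyperfilter ℕ) (𝓝 ⟨a, ha.1.1⟩) := by
    rw [tendsto_subtype_rng]
    have h0 : Tendsto (fun n : ℕ => a - (a - 1) / ((n : ℝ) + 2)) atTop (𝓝 (a - 0)) :=
      tendsto_const_nhds.sub (tendsto_const_nhds.div_atTop
        (tendsto_atTop_add_const_right _ _ tendsto_natCast_atTop_atTop))
    rw [sub_zero] at h0
    exact h0.mono_left (Nat.cofinite_eq_atTop ▸ hyperfilter_le_cofinite)
  choose m hmax using fun n => exists_mem_energyArgmax (d := d) (u n).2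
  obtain ⟨μ, -, hμ⟩ := isCompact_univ.ultrafilter_le_nhds ((hyperfilter ℕ).map m) (by simp)
  have hm : Tendsto m (hyperfilter ℕ) (𝓝 μ) := hμ
  obtain ⟨b, hb⟩ := hcon μ (mem_energyArgmax_of_tendsto hu hm hmax)
  -- The radius must be fixed before `n`, so it is chosen for the smallest exponent; as `2r ≤ 1`,
  -- larger exponents only decrease the power.
  obtain ⟨r, hr0, hr, hr'⟩ := exists_radius d (β := (1 + a) / 2 - 1) (by linarith)
  obtain ⟨n, hs, hmass⟩ := ((eventually_support_subset hu hm hmax hb ha1 hr0).and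
    (eventually_all.2 (eventually_measureReal_doubleCap_ge hm hb hr0))).exists
  have hn : (1 + a) / 2 ≤ (u n : ℝ) := hpos n
  have h2r : 2 * r ≤ 1 := by
    have : (1 : ℝ) / (4 * (d + 1)) ≤ 1 / 2 := by
      apply one_div_le_one_div_of_le two_pos
      linarith [(Nat.cast_nonneg d : (0 : ℝ) ≤ d)]
    linarith
  have hE := two_energy_le_of_support_subset_doubleCap hd (by linarith) (hmax n) b hr
    ((Real.rpow_le_rpow_of_exponent_ge (by linarith) h2r (by linarith)).trans hr') hmass hs
  exact absurd (ha.2 (⟨(u n).2, fun ν => by linarith [hmax n ν]⟩ : (u n : ℝ) ∈ simplexExponents d))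
    (not_le.2 (hlt n))

end Limit

theorem theorem3p4 (d : ℕ) (hd : 1 ≤ d) (hfin : thresholdExponent d < ⊤) :
    equiSimplexMeasures d ⊂ energyArgmax d (thresholdExponent d).toReal ∧
      ∃ μ ∈ energyArgmax d (thresholdExponent d).toReal,
        ∀ ν ∈ equiSimplexMeasures d, ¬ EssEquiv μ ν := by
  have hl := isLeast_toReal_thresholdExponent hd hfin
  have h1 := one_le_of_mem_simplexExponents hd hl.1
  generalize (thresholdExponent d).toReal = a at *
  -- Equidistribution passes across essential equivalence, so this one maximizer settles both
  -- strictness and non-equivalence.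
  obtain ⟨μ, hμ, hne⟩ : ∃ μ ∈ energyArgmax d a, ∀ b, ¬ IsEquidistributed μ b := by
    rcases h1.eq_or_lt with rfl | h1
    · exact exists_mem_energyArgmax_one hd hl.1
    · exact exists_mem_energyArgmax_of_one_lt hd hl h1
  refine ⟨⟨fun ν hν => ?_, fun hsub => ?_⟩, μ, hμ, fun ν hν hμν => ?_⟩
  · obtain ⟨b, hb⟩ := exists_isEquidistributed_of_mem_equiSimplexMeasures hν
    exact (hb.mem_energyArgmax_iff hl.1.1).2 hl.1
  · obtain ⟨b, hb⟩ := exists_isEquidistributed_of_mem_equiSimplexMeasures (hsub hμ)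
    exact hne b hb
  · obtain ⟨b, hb⟩ := exists_isEquidistributed_of_mem_equiSimplexMeasures hν
    obtain ⟨c, hc⟩ := hb.of_essEquiv hμν
    exact hne c hc
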